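/- For $t,s>0$ with $t+s>1$ let $\Sigma_t^s(\mathbf R)$ be the space of all $f\in C^\infty(\mathbf R)$ such that for every $h>0$ $$\|f\|_{h}=\sup_{a,b\in\mathbf N,\ x\in\mathbf R}\frac{|x^aD^bf(x)|}{h^{a+b}\,a!^t\,b!^s}<\infty ,$$ with the topology given by these norms, and let $(\Sigma_t^s)'(\mathbf R)$ be its topological dual, acting conjugate linearly and written $(u,\varphi)$; a bounded continuous function $u$ acts by $(u,\varphi)=\int u\,\overline{\varphi}\,dx$. For $\psi\in\Sigma_t^s(\mathbf R)\setminus 0$ and $u\in(\Sigma_t^s)'(\mathbf R)$ put $$V_\psi u(x,\xi)=(2\pi)^{-1/2}\bigl(u,\,e^{i\xi\,\cdot}\,\psi(\cdot-x)\bigr),\qquad x,\xi\in\mathbf R .$$ The wave front set $\mathrm{WF}^{t,s}(u)\subseteq\mathbf R^2\setminus 0$ is defined as follows: $(x_0,\xi_0)\in\mathbf R^2\setminus0$ is not in $\mathrm{WF}^{t,s}(u)$ if there is an open set $U\subseteq\mathbf R^2\setminus 0$ containing $(x_0,\xi_0)$ such that $$\sup_{\lambda>0,\ (x,\xi)\in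 U}e^{r\lambda}\,|V_\psi u(\lambda^tx,\lambda^s\xi)|<\infty\qquad\text{for all } r>0 .$$ **Theorem.** Let $c\in\mathbf R\setminus 0$. The following holds for every choice of the window $\psi\in\Sigma_t^s(\mathbf R)\setminus0$, where $s=t(m-1)$ in (i) and $s=t(\alpha-1)$ in (ii). (i) If $m\ge 2$ is an integer, $u(x)=e^{icx^m}$ and $t>\frac1{m-1}$, then $$\mathrm{WF}^{t,t(m-1)}(u)=\{(x,cmx^{m-1})\in\mathbf R^2:\ x\neq0\}.$$ (ii) If $\alpha>1$ is a real number that is not an even integer, $u(x)=e^{ic|x|^\alpha}$ and $t>\frac1{\alpha-1}$, then $$\{0\}\times(\mathbf R\setminus0)\subseteq\mathrm{WF}^{t,t(\alpha-1)}(u)\subseteq\{(x,c\alpha\operatorname{sgn}(x)|x|^{\alpha-1})\in\mathbf R^2:\ x\neq0\}\cup\{0\}\times(\mathbf R\setminus0).$$ -/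

import Mathlib

noncomputable section

namespace GelfandShilov

open MeasureTheory
open scoped ContDiff Nat BoundedContinuousFunction

/-! ### The Beurling type Gelfand–Shilov space on the real line -/

/-- The quotient `|x ^ a * D ^ b f (x)| / (h ^ (a + b) * a! ^ t * b! ^ s)`,
indexed by `p = (a, b, x)`. -/
def ratio (t s h : ℝ) (f : ℝ → ℂ) (p : ℕ × ℕ × ℝ) : ℝ :=
  ‖((p.2.2 : ℝ) : ℂ) ^ p.1 * iteratedDeriv p.2.1 f p.2.2‖ /
    (h ^ (p.1 + p.2.1) * (p.1 ! : ℝ) ^ t * (p.2.1 ! : ℝ) ^ s)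

/-- The norm of `𝓢_{t,h}^s(ℝ)`: the supremum of `ratio` over all `a`, `b` and `x`. -/
def gsNorm (t s h : ℝ) (f : ℝ → ℂ) : ℝ := ⨆ p : ℕ × ℕ × ℝ, ratio t s h f p

theorem weight_pos (t s : ℝ) {h : ℝ} (hh : 0 < h) (a b : ℕ) :
    0 < h ^ (a + b) * (a ! : ℝ) ^ t * (b ! : ℝ) ^ s := by
  have := Nat.factorial_pos a
  have := Nat.factorial_pos b
  positivity

theorem bddAbove_ratio_iff (t s : ℝ) {h : ℝ} (hh : 0 < h) (f : ℝ → ℂ) :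
    BddAbove (Set.range (ratio t s h f)) ↔ ∃ C : ℝ, 0 ≤ C ∧ ∀ (a b : ℕ) (x : ℝ),
      |x| ^ a * ‖iteratedDeriv b f x‖ ≤ C * (h ^ (a + b) * (a ! : ℝ) ^ t * (b ! : ℝ) ^ s) := by
  constructor
  · rintro ⟨C, hC⟩
    refine ⟨C, ?_, fun a b x => ?_⟩
    · refine le_trans ?_ (hC ⟨(0, 0, 0), rfl⟩)
      exact div_nonneg (norm_nonneg _) (weight_pos t s hh 0 0).le
    · have := hC ⟨(a, b, x), rfl⟩
      rw [ratio, div_le_iff₀ (weight_pos t s hh a b)] at this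
      simpa using this
  · rintro ⟨C, -, hC⟩
    refine ⟨C, ?_⟩
    rintro _ ⟨⟨a, b, x⟩, rfl⟩
    rw [ratio, div_le_iff₀ (weight_pos t s hh a b)]
    simpa using hC a b x

/-- `Σ_t^s(ℝ) = ⋂_{h > 0} 𝓢_{t,h}^s(ℝ)`: the smooth functions all of whose norms `gsNorm t s h`,
`h > 0`, are finite. -/
def Space (t s : ℝ) : Submodule ℂ (ℝ → ℂ) where
  carrier := {f | ContDiff ℝ ∞ f ∧ ∀ h : ℝ, 0 < h → BddAbove (Set.range (ratio t s h f))}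
  zero_mem' := by
    refine ⟨contDiff_const, fun h hh => ⟨0, ?_⟩⟩
    rintro _ ⟨⟨a, b, x⟩, rfl⟩
    have : iteratedDeriv b (0 : ℝ → ℂ) x = 0 := by
      rw [iteratedDeriv_eq_iteratedFDeriv]
      simp
    simp [ratio, this]
  add_mem' := by
    rintro f g ⟨hf, hf'⟩ ⟨hg, hg'⟩
    refine ⟨hf.add hg, fun h hh => ?_⟩
    obtain ⟨C, hC0, hC⟩ := (bddAbove_ratio_iff t s hh f).1 (hf' h hh)
    obtain ⟨D, hD0, hD⟩ := (bddAbove_ratio_iff t s hh g).1 (hg' h hh)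
    refine (bddAbove_ratio_iff t s hh _).2 ⟨C + D, by positivity, fun a b x => ?_⟩
    rw [iteratedDeriv_add (hf.contDiffAt.of_le (by exact_mod_cast le_top))
      (hg.contDiffAt.of_le (by exact_mod_cast le_top))]
    calc |x| ^ a * ‖iteratedDeriv b f x + iteratedDeriv b g x‖
        ≤ |x| ^ a * (‖iteratedDeriv b f x‖ + ‖iteratedDeriv b g x‖) := by
          gcongr; exact norm_add_le _ _
      _ ≤ _ := by rw [mul_add, add_mul]; exact add_le_add (hC a b x) (hD a b x)
  smul_mem' := by
    rintro c f ⟨hf, hf'⟩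
    refine ⟨contDiff_const.smul hf, fun h hh => ?_⟩
    obtain ⟨C, hC0, hC⟩ := (bddAbove_ratio_iff t s hh f).1 (hf' h hh)
    refine (bddAbove_ratio_iff t s hh _).2 ⟨‖c‖ * C, by positivity, fun a b x => ?_⟩
    rw [iteratedDeriv_const_smul (hf.contDiffAt.of_le (by exact_mod_cast le_top)), norm_smul,
      mul_left_comm, mul_assoc]
    exact mul_le_mul_of_nonneg_left (hC a b x) (norm_nonneg c)

/-! ### Translations and modulations act on the space -/

theorem exists_pow_le (A h s : ℝ) (hA : 0 ≤ A) (hh : 0 < h) (hs : 0 < s) :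
    ∃ K : ℝ, 0 ≤ K ∧ ∀ i : ℕ, A ^ i ≤ K * (h ^ i * (i ! : ℝ) ^ s) := by
  have hB : 0 ≤ A / h := by positivity
  refine ⟨Real.exp ((A / h) ^ s⁻¹) ^ s, by positivity, fun i => ?_⟩
  have h1 := Real.pow_div_factorial_le_exp (x := (A / h) ^ s⁻¹) (by positivity) i
  have hi : (0 : ℝ) < i ! := by exact_mod_cast Nat.factorial_pos i
  rw [div_le_iff₀ hi] at h1
  have h2 := Real.rpow_le_rpow (by positivity) h1 hs.le
  rw [Real.mul_rpow (by positivity) hi.le, ← Real.rpow_natCast, ← Real.rpow_mul hB,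
    ← Real.rpow_mul hB, mul_right_comm, inv_mul_cancel₀ hs.ne', one_mul, Real.rpow_natCast,
    div_pow, div_le_iff₀ (by positivity)] at h2
  linarith

theorem factorial_rpow_mul_le (s : ℝ) (hs : 0 < s) {n i : ℕ} (hi : i ≤ n) :
    (i ! : ℝ) ^ s * ((n - i)! : ℝ) ^ s ≤ (n ! : ℝ) ^ s := by
  rw [← Real.mul_rpow (by positivity) (by positivity)]
  refine Real.rpow_le_rpow (by positivity) ?_ hs.le
  exact_mod_cast Nat.le_of_dvd (Nat.factorial_pos n) (Nat.factorial_mul_factorial_dvd_factorial hi)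

theorem sum_choose_le (s h K M : ℝ) (hs : 0 < s) (hh : 0 < h) (hK : 0 ≤ K) (hM : 0 ≤ M) (n : ℕ) :
    ∑ i ∈ Finset.range (n + 1), (n.choose i : ℝ) *
      ((K * ((h / 2) ^ i * (i ! : ℝ) ^ s)) * (M * ((h / 2) ^ (n - i) * ((n - i)! : ℝ) ^ s)))
      ≤ K * M * (h ^ n * (n ! : ℝ) ^ s) := by
  calc _ ≤ ∑ i ∈ Finset.range (n + 1), (n.choose i : ℝ) *
        (K * M * ((h / 2) ^ n * (n ! : ℝ) ^ s)) := by
        refine Finset.sum_le_sum fun i hi => ?_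
        have hin : i ≤ n := Nat.lt_succ_iff.1 (Finset.mem_range.1 hi)
        refine mul_le_mul_of_nonneg_left ?_ (Nat.cast_nonneg _)
        calc _ = K * M * ((h / 2) ^ i * (h / 2) ^ (n - i) *
              ((i ! : ℝ) ^ s * ((n - i)! : ℝ) ^ s)) := by ring
          _ ≤ _ := by
            rw [← pow_add, Nat.add_sub_cancel' hin]
            gcongr
            exact factorial_rpow_mul_le s hs hin
    _ = (2 ^ n : ℝ) * (K * M * ((h / 2) ^ n * (n ! : ℝ) ^ s)) := by
        rw [← Finset.sum_mul]
        congr 1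
        exact_mod_cast Nat.sum_range_choose n
    _ = _ := by rw [div_pow]; field_simp

theorem translation_mem {t s : ℝ} (ht : 0 < t) {f : ℝ → ℂ} (hf : f ∈ Space t s) (x : ℝ) :
    (fun y => f (y - x)) ∈ Space t s := by
  obtain ⟨hf1, hf2⟩ := hf
  refine ⟨hf1.comp (contDiff_id.sub contDiff_const), fun h hh => ?_⟩
  obtain ⟨C, hC0, hC⟩ := (bddAbove_ratio_iff t s (half_pos hh) f).1 (hf2 _ (half_pos hh))
  obtain ⟨K, hK0, hK⟩ := exists_pow_le |x| (h / 2) t (abs_nonneg x) (half_pos hh) ht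
  refine (bddAbove_ratio_iff t s hh _).2 ⟨K * C, by positivity, fun a b y => ?_⟩
  rw [iteratedDeriv_comp_sub_const]
  set z := y - x with hz
  set N := ‖iteratedDeriv b f z‖
  have hM : 0 ≤ C * ((h / 2) ^ b * (b ! : ℝ) ^ s) := by positivity
  have hy : |y| ≤ |x| + |z| := by
    calc |y| = |x + z| := by rw [hz]; congr 1; ring
      _ ≤ _ := abs_add_le _ _
  calc |y| ^ a * N ≤ (|x| + |z|) ^ a * N := by gcongr
    _ = ∑ i ∈ Finset.range (a + 1), (a.choose i : ℝ) * (|x| ^ i * (|z| ^ (a - i) * N)) := by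
        rw [add_pow, Finset.sum_mul]
        exact Finset.sum_congr rfl fun i _ => by ring
    _ ≤ ∑ i ∈ Finset.range (a + 1), (a.choose i : ℝ) * ((K * ((h / 2) ^ i * (i ! : ℝ) ^ t)) *
          ((C * ((h / 2) ^ b * (b ! : ℝ) ^ s)) * ((h / 2) ^ (a - i) * ((a - i)! : ℝ) ^ t))) := by
        refine Finset.sum_le_sum fun i _ => ?_
        refine mul_le_mul_of_nonneg_left (mul_le_mul (hK i) ?_ (by positivity) (by positivity))
          (Nat.cast_nonneg _)
        · refine (hC (a - i) b z).trans (le_of_eq ?_)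
          rw [pow_add]; ring
    _ ≤ K * (C * ((h / 2) ^ b * (b ! : ℝ) ^ s)) * (h ^ a * (a ! : ℝ) ^ t) :=
        sum_choose_le t h K _ ht hh hK0 hM a
    _ ≤ K * (C * (h ^ b * (b ! : ℝ) ^ s)) * (h ^ a * (a ! : ℝ) ^ t) := by
        gcongr; linarith
    _ = _ := by rw [pow_add]; ring

theorem contDiff_character (ξ : ℝ) :
    ContDiff ℝ ∞ (fun y : ℝ => Complex.exp (Complex.I * (y * ξ : ℝ))) :=
  (contDiff_const.mul (Complex.ofRealCLM.contDiff.comp (contDiff_id.mul contDiff_const))).cexp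

theorem iteratedDeriv_character (ξ : ℝ) (n : ℕ) :
    iteratedDeriv n (fun y : ℝ => Complex.exp (Complex.I * (y * ξ : ℝ))) =
      fun y : ℝ => (Complex.I * ξ) ^ n * Complex.exp (Complex.I * (y * ξ : ℝ)) := by
  induction n with
  | zero => simp
  | succ n ih =>
    rw [iteratedDeriv_succ, ih]
    funext y
    have h1 : HasDerivAt (fun y : ℝ => ((y * ξ : ℝ) : ℂ)) (ξ : ℂ) y := by
      simpa using ((hasDerivAt_id y).mul_const ξ).ofReal_comp
    have h2 := (((h1.const_mul Complex.I).cexp).const_mul ((Complex.I * ξ) ^ n)).deriv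
    rw [h2, pow_succ]
    ring

theorem modulation_mem {t s : ℝ} (hs : 0 < s) {f : ℝ → ℂ} (hf : f ∈ Space t s) (ξ : ℝ) :
    (fun y : ℝ => Complex.exp (Complex.I * (y * ξ : ℝ)) * f y) ∈ Space t s := by
  obtain ⟨hf1, hf2⟩ := hf
  refine ⟨(contDiff_character ξ).mul hf1, fun h hh => ?_⟩
  obtain ⟨C, hC0, hC⟩ := (bddAbove_ratio_iff t s (half_pos hh) f).1 (hf2 _ (half_pos hh))
  obtain ⟨K, hK0, hK⟩ := exists_pow_le |ξ| (h / 2) s (abs_nonneg ξ) (half_pos hh) hs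
  refine (bddAbove_ratio_iff t s hh _).2 ⟨K * C, by positivity, fun a b y => ?_⟩
  have hM : 0 ≤ C * ((h / 2) ^ a * (a ! : ℝ) ^ t) := by positivity
  rw [iteratedDeriv_fun_mul ((contDiff_character ξ).contDiffAt.of_le (by exact_mod_cast le_top))
    (hf1.contDiffAt.of_le (by exact_mod_cast le_top))]
  have hnorm : ∀ i : ℕ, ‖(b.choose i : ℂ) *
      iteratedDeriv i (fun y : ℝ => Complex.exp (Complex.I * (y * ξ : ℝ))) y *
      iteratedDeriv (b - i) f y‖ = (b.choose i : ℝ) * (|ξ| ^ i * ‖iteratedDeriv (b - i) f y‖) := by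
    intro i
    rw [iteratedDeriv_character, norm_mul, norm_mul, norm_mul, norm_pow, norm_mul,
      mul_comm Complex.I ((y * ξ : ℝ) : ℂ), Complex.norm_exp_ofReal_mul_I]
    simp [mul_assoc]
  calc _ ≤ |y| ^ a * ∑ i ∈ Finset.range (b + 1),
        (b.choose i : ℝ) * (|ξ| ^ i * ‖iteratedDeriv (b - i) f y‖) := by
        gcongr
        refine (norm_sum_le _ _).trans (le_of_eq (Finset.sum_congr rfl fun i _ => hnorm i))
    _ = ∑ i ∈ Finset.range (b + 1),
        (b.choose i : ℝ) * (|ξ| ^ i * (|y| ^ a * ‖iteratedDeriv (b - i) f y‖)) := by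
        rw [Finset.mul_sum]
        exact Finset.sum_congr rfl fun i _ => by ring
    _ ≤ ∑ i ∈ Finset.range (b + 1), (b.choose i : ℝ) * ((K * ((h / 2) ^ i * (i ! : ℝ) ^ s)) *
          ((C * ((h / 2) ^ a * (a ! : ℝ) ^ t)) * ((h / 2) ^ (b - i) * ((b - i)! : ℝ) ^ s))) := by
        refine Finset.sum_le_sum fun i _ => ?_
        refine mul_le_mul_of_nonneg_left (mul_le_mul (hK i) ?_ (by positivity) (by positivity))
          (Nat.cast_nonneg _)
        · refine (hC a (b - i) y).trans (le_of_eq ?_)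
          rw [pow_add]; ring
    _ ≤ K * (C * ((h / 2) ^ a * (a ! : ℝ) ^ t)) * (h ^ b * (b ! : ℝ) ^ s) :=
        sum_choose_le s h K _ hs hh hK0 hM b
    _ ≤ K * (C * (h ^ a * (a ! : ℝ) ^ t)) * (h ^ b * (b ! : ℝ) ^ s) := by
        gcongr; linarith
    _ = _ := by rw [pow_add]; ring

/-- The time-frequency shift `M_ξ T_x ψ (y) = e^{i y ξ} ψ(y - x)`. -/
def shift {t s : ℝ} (ht : 0 < t) (hs : 0 < s) (x ξ : ℝ) (ψ : Space t s) : Space t s :=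
  ⟨fun y : ℝ => Complex.exp (Complex.I * (y * ξ : ℝ)) * (ψ : ℝ → ℂ) (y - x),
    modulation_mem hs (translation_mem ht ψ.2 x) ξ⟩

/-! ### Ultradistributions -/

/-- The topological dual `(Σ_t^s)'(ℝ)`: conjugate linear functionals on `Σ_t^s(ℝ)` that are
continuous. The norms `gsNorm t s h` define the topology and are decreasing in `h`, so continuity
means boundedness with respect to one of them. -/
structure Ultradistribution (t s : ℝ) where
  /-- the conjugate linear action `g ↦ (u, g)` -/
  pairing : Space t s →ₛₗ[starRingEnd ℂ] ℂ
  continuous' : ∃ h : ℝ, 0 < h ∧ ∃ C : ℝ, ∀ g : Space t s,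
    ‖pairing g‖ ≤ C * gsNorm t s h (g : ℝ → ℂ)

theorem one_add_sq_mul_norm_le {t s : ℝ} (g : Space t s) (x : ℝ) :
    (1 + x ^ 2) * ‖(g : ℝ → ℂ) x‖ ≤ (1 + 2 ^ t) * gsNorm t s 1 (g : ℝ → ℂ) := by
  have hb := g.2.2 1 one_pos
  have h0 := le_ciSup hb (0, 0, x)
  have h2 := le_ciSup hb (2, 0, x)
  have e0 : ratio t s 1 (g : ℝ → ℂ) (0, 0, x) = ‖(g : ℝ → ℂ) x‖ := by simp [ratio]
  have e2 : ratio t s 1 (g : ℝ → ℂ) (2, 0, x) = x ^ 2 * ‖(g : ℝ → ℂ) x‖ / 2 ^ t := by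
    simp [ratio]
  rw [e0] at h0
  rw [e2, div_le_iff₀ (by positivity)] at h2
  change ‖(g : ℝ → ℂ) x‖ ≤ gsNorm t s 1 (g : ℝ → ℂ) at h0
  change _ ≤ gsNorm t s 1 (g : ℝ → ℂ) * _ at h2
  linarith

theorem norm_le_inv {t s : ℝ} (g : Space t s) (x : ℝ) :
    ‖(g : ℝ → ℂ) x‖ ≤ (1 + 2 ^ t) * gsNorm t s 1 (g : ℝ → ℂ) * (1 + x ^ 2)⁻¹ := by
  rw [← div_eq_mul_inv, le_div_iff₀ (by positivity), mul_comm]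
  exact one_add_sq_mul_norm_le g x

theorem norm_pair_le {t s : ℝ} (u : ℝ →ᵇ ℂ) (g : Space t s) (x : ℝ) :
    ‖u x * (starRingEnd ℂ) ((g : ℝ → ℂ) x)‖ ≤
      ‖u‖ * ((1 + 2 ^ t) * gsNorm t s 1 (g : ℝ → ℂ)) * (1 + x ^ 2)⁻¹ := by
  rw [norm_mul, RCLike.norm_conj, mul_assoc]
  exact mul_le_mul (u.norm_coe_le_norm x) (norm_le_inv g x) (norm_nonneg _) (norm_nonneg _)

theorem integrable_pair {t s : ℝ} (u : ℝ →ᵇ ℂ) (g : Space t s) :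
    Integrable (fun y : ℝ => u y * (starRingEnd ℂ) ((g : ℝ → ℂ) y)) := by
  refine (integrable_inv_one_add_sq.const_mul
    (‖u‖ * ((1 + 2 ^ t) * gsNorm t s 1 (g : ℝ → ℂ)))).mono' ?_
    (Filter.Eventually.of_forall fun x => norm_pair_le u g x)
  exact (u.continuous.mul (Complex.continuous_conj.comp g.2.1.continuous)).aestronglyMeasurable

/-- A bounded continuous function `u` as an ultradistribution, consistently with the `L²` inner
product: `(u, g) = ∫ u(y) conj(g(y)) dy`. -/
def ofFunction (t s : ℝ) (u : ℝ →ᵇ ℂ) : Ultradistribution t s where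
  pairing :=
    { toFun := fun g => ∫ y : ℝ, u y * (starRingEnd ℂ) ((g : ℝ → ℂ) y)
      map_add' := fun g k => by
        rw [← integral_add (integrable_pair u g) (integrable_pair u k)]
        refine integral_congr_ae (Filter.Eventually.of_forall fun y => ?_)
        simp [mul_add]
      map_smul' := fun c g => by
        rw [smul_eq_mul, ← integral_const_mul]
        refine integral_congr_ae (Filter.Eventually.of_forall fun y => ?_)
        simp [mul_left_comm] }
  continuous' := by
    refine ⟨1, one_pos, ‖u‖ * (1 + 2 ^ t) * ∫ x : ℝ, (1 + x ^ 2)⁻¹, fun g => ?_⟩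
    calc _ ≤ ∫ x : ℝ, ‖u‖ * ((1 + 2 ^ t) * gsNorm t s 1 (g : ℝ → ℂ)) * (1 + x ^ 2)⁻¹ :=
          norm_integral_le_of_norm_le (integrable_inv_one_add_sq.const_mul _)
            (Filter.Eventually.of_forall fun x => norm_pair_le u g x)
      _ = _ := by rw [integral_const_mul]; ring

/-! ### The short-time Fourier transform and the wave front set -/

/-- The short-time Fourier transform `V_ψ u (x, ξ) = (2π)^{-1/2} (u, M_ξ T_x ψ)`. -/
def stft {t s : ℝ} (ht : 0 < t) (hs : 0 < s) (ψ : Space t s) (u : Ultradistribution t s)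
    (x ξ : ℝ) : ℂ :=
  (((2 * Real.pi) ^ (-(1 / 2) : ℝ) : ℝ) : ℂ) * u.pairing (shift ht hs x ξ ψ)

/-- The `t,s`-Gelfand–Shilov wave front set, computed with the window `ψ`: a point `z ≠ 0` of the
phase space is outside it when, for some open `U ∌ 0` around `z` and all `r > 0`, the supremum of
`e^{r μ} |V_ψ u (μ^t x, μ^s ξ)|` over `μ > 0` and `(x, ξ) ∈ U` is finite. -/
def waveFrontSet {t s : ℝ} (ht : 0 < t) (hs : 0 < s) (ψ : Space t s)
    (u : Ultradistribution t s) : Set (ℝ × ℝ) :=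
  {z | z ≠ 0 ∧ ¬ ∃ U : Set (ℝ × ℝ), IsOpen U ∧ (0 : ℝ × ℝ) ∉ U ∧ z ∈ U ∧
    ∀ r : ℝ, 0 < r → ∃ C : ℝ, ∀ μ : ℝ, 0 < μ → ∀ p ∈ U,
      Real.exp (r * μ) * ‖stft ht hs ψ u (μ ^ t * p.1) (μ ^ s * p.2)‖ ≤ C}

/-! ### Chirps -/

/-- `x ↦ e^{i θ(x)}` for a continuous real phase `θ`. -/
def oscillation (θ : ℝ → ℝ) (hθ : Continuous θ) : ℝ →ᵇ ℂ :=
  BoundedContinuousFunction.ofNormedAddCommGroup (fun x : ℝ => Complex.exp (Complex.I * (θ x : ℂ)))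
    (Complex.continuous_exp.comp
      (continuous_const.mul (Complex.continuous_ofReal.comp hθ))) 1
    (fun x => by rw [mul_comm, Complex.norm_exp_ofReal_mul_I])

/-- `u(x) = e^{i c x^m}`. -/
def monomialChirp (c : ℝ) (m : ℕ) : ℝ →ᵇ ℂ :=
  oscillation (fun x => c * x ^ m) (by fun_prop)

/-- `u(x) = e^{i c |x|^α}` with `α ≥ 0`. -/
def powerChirp (c α : ℝ) (hα : 0 ≤ α) : ℝ →ᵇ ℂ :=
  oscillation (fun x => c * |x| ^ α)
    (continuous_const.mul (continuous_abs.rpow_const fun _ => Or.inr hα))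

/-! ### Positivity of the indices `t` and `s = t (β - 1)` -/

theorem index_pos {β t : ℝ} (hβ : 1 < β) (ht : 1 / (β - 1) < t) : 0 < t :=
  (one_div_pos.2 (sub_pos.2 hβ)).trans ht

theorem index_mul_pos {β t : ℝ} (hβ : 1 < β) (ht : 1 / (β - 1) < t) : 0 < t * (β - 1) :=
  mul_pos (index_pos hβ ht) (sub_pos.2 hβ)

end GelfandShilov

end

/-!
A point off the curve `ξ = θ'(x)` is not stationary for the phase `y ↦ θ(x + y) - ξ y` of
`V_ψ u (x, ξ)`. By homogeneity the scaling `(x, ξ) ↦ (μ ^ t x, μ ^ s ξ)` replaces this phase by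
`μ ^ (s + t) φ(y / μ ^ t)`, and `⌊μ⌋` integrations by parts yield decay `e ^ (-r μ)` for every `r`:
analyticity of `θ` controls the derivatives of the phase and the decay of `ψ` and its derivatives
pays for the factorials, since `1 ≤ s`.

Conversely, if the wave front set of `e ^ (i c x ^ m)` missed a point of the curve, it would miss
the whole half-plane on that side of the axis `x = 0`. Then `V_ψ u (x, ·)` would be integrable with
integral tending to zero as `x` tends to infinity, contradicting the inversion formula. At `x = 0`,
the non-smooth term `|y| ^ α` of `e ^ (i c |y| ^ α)` forbids one-sided fast decay of the Fourier
transform: this is seen by testing against rescalings of `(1 + i y) ^ (-n - 1)`, whose Fourier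
transform is supported by a half-line, and the pairing of this kernel with `|y| ^ α` is a multiple
of `cos (π (α + 1) / 2)`.
-/

noncomputable section

namespace GelfandShilov

open MeasureTheory Filter Topology
open scoped ContDiff Nat BoundedContinuousFunction NNReal

/-! ### Weighted norms of jets -/

section Jet

variable {E : Type*} [NormedAddCommGroup E] [NormedSpace ℝ E]

/-- The weighted `ℓ¹` norm `∑_{j ≤ n} ρ ^ j / j! * ‖f⁽ʲ⁾(y)‖` of the `n`-jet of `f` at `y`. With
these weights it is submultiplicative. -/
def jetNorm (n : ℕ) (ρ : ℝ) (f : ℝ → E) (y : ℝ) : ℝ :=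
  ∑ j ∈ Finset.range (n + 1), ρ ^ j / j ! * ‖iteratedDeriv j f y‖

theorem jetNorm_nonneg (n : ℕ) {ρ : ℝ} (hρ : 0 ≤ ρ) (f : ℝ → E) (y : ℝ) : 0 ≤ jetNorm n ρ f y :=
  Finset.sum_nonneg fun j _ => by positivity

theorem jetNorm_zero_left (ρ : ℝ) (f : ℝ → E) (y : ℝ) : jetNorm 0 ρ f y = ‖f y‖ := by
  simp [jetNorm]

theorem jetNorm_eq_norm_add_sum (n : ℕ) (ρ : ℝ) (f : ℝ → E) (y : ℝ) :
    jetNorm n ρ f y =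
      ‖f y‖ + ∑ j ∈ Finset.range n, ρ ^ (j + 1) / (j + 1)! * ‖iteratedDeriv (j + 1) f y‖ := by
  rw [jetNorm, Finset.sum_range_succ', add_comm]
  simp

theorem jetNorm_mono (n : ℕ) {ρ' ρ : ℝ} (h0 : 0 ≤ ρ') (h : ρ' ≤ ρ) (f : ℝ → E) (y : ℝ) :
    jetNorm n ρ' f y ≤ jetNorm n ρ f y :=
  Finset.sum_le_sum fun j _ => by gcongr

theorem jetNorm_congr (n : ℕ) (ρ : ℝ) {f g : ℝ → E} {y : ℝ} (h : f =ᶠ[𝓝 y] g) :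
    jetNorm n ρ f y = jetNorm n ρ g y :=
  Finset.sum_congr rfl fun j _ => by rw [h.iteratedDeriv_eq]

theorem jetNorm_const (n : ℕ) (ρ : ℝ) (c : E) (y : ℝ) : jetNorm n ρ (fun _ => c) y = ‖c‖ := by
  simp [jetNorm_eq_norm_add_sum, iteratedDeriv_const]

theorem jetNorm_add_le (n : ℕ) {ρ : ℝ} (hρ : 0 ≤ ρ) {f g : ℝ → E} {y : ℝ}
    (hf : ContDiffAt ℝ n f y) (hg : ContDiffAt ℝ n g y) :
    jetNorm n ρ (fun w => f w + g w) y ≤ jetNorm n ρ f y + jetNorm n ρ g y := by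
  simp only [jetNorm, ← Finset.sum_add_distrib, ← mul_add]
  refine Finset.sum_le_sum fun j hj => ?_
  have hjn : (j : WithTop ℕ∞) ≤ n := by exact_mod_cast Finset.mem_range_succ_iff.1 hj
  rw [iteratedDeriv_fun_add (hf.of_le hjn) (hg.of_le hjn)]
  gcongr
  exact norm_add_le _ _

theorem jetNorm_comp_add_mul (n : ℕ) (ρ : ℝ) (f : ℝ → E) (x : ℝ) {κ : ℝ} (hκ : 0 ≤ κ) (y : ℝ) :
    jetNorm n ρ (fun w => f (x + κ * w)) y = jetNorm n (ρ * κ) f (x + κ * y) := by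
  have hderiv (j : ℕ) : iteratedDeriv j (fun w => f (x + κ * w)) =
      fun w => κ ^ j • iteratedDeriv j f (x + κ * w) := by
    induction j with
    | zero => simp
    | succ j ih =>
      funext w
      rw [iteratedDeriv_succ, ih, iteratedDeriv_succ, deriv_fun_const_smul_field,
        deriv_comp_mul_left κ fun v => iteratedDeriv j f (x + v), deriv_comp_const_add, smul_smul,
        pow_succ]
  refine Finset.sum_congr rfl fun j _ => ?_
  rw [hderiv, norm_smul, Real.norm_of_nonneg (by positivity), mul_pow]
  ring

/-- Shrinking the radius costs one derivative, as in Cauchy's estimate. -/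
theorem jetNorm_deriv_le (n : ℕ) {ρ' ρ : ℝ} (h0 : 0 ≤ ρ') (h : ρ' < ρ) (f : ℝ → E) (y : ℝ) :
    jetNorm n ρ' (deriv f) y ≤ (ρ - ρ')⁻¹ * jetNorm (n + 1) ρ f y := by
  have hd : 0 < ρ - ρ' := sub_pos.2 h
  have hpow (j : ℕ) : ((j : ℝ) + 1) * ρ' ^ j * (ρ - ρ') ≤ ρ ^ (j + 1) := by
    have hterm := Finset.single_le_sum
      (f := fun i => ρ' ^ i * (ρ - ρ') ^ (j + 1 - i) * ((j + 1).choose i : ℝ))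
      (fun i _ => by positivity) (Finset.mem_range.2 (by lia : j < j + 1 + 1))
    rw [← add_pow, add_sub_cancel] at hterm
    simpa [mul_comm, mul_assoc, mul_left_comm] using hterm
  rw [jetNorm, jetNorm, Finset.sum_range_succ' _ (n + 1), mul_add, Finset.mul_sum]
  refine le_add_of_le_of_nonneg (Finset.sum_le_sum fun j _ => ?_) (by positivity)
  rw [← iteratedDeriv_succ', ← mul_assoc]
  gcongr
  rw [← div_eq_inv_mul, le_div_iff₀ hd, Nat.factorial_succ, Nat.cast_mul, Nat.cast_succ,
    ← mul_div_mul_left (ρ' ^ j) (j ! : ℝ) (Nat.cast_add_one_ne_zero j), div_mul_eq_mul_div]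
  gcongr
  exact hpow j

end Jet

theorem jetNorm_mul_le {𝔸 : Type*} [NormedRing 𝔸] [NormedAlgebra ℝ 𝔸] {n : ℕ} {ρ : ℝ}
    (hρ : 0 ≤ ρ) {f g : ℝ → 𝔸} {y : ℝ} (hf : ContDiffAt ℝ n f y) (hg : ContDiffAt ℝ n g y) :
    jetNorm n ρ (fun w => f w * g w) y ≤ jetNorm n ρ f y * jetNorm n ρ g y := by
  set A : ℕ → ℝ := fun j => ρ ^ j / j ! * ‖iteratedDeriv j f y‖
  set B : ℕ → ℝ := fun j => ρ ^ j / j ! * ‖iteratedDeriv j g y‖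
  have hA0 (j) : 0 ≤ A j := by positivity
  have hB0 (j) : 0 ≤ B j := by positivity
  have leibniz (j) (hj : j ≤ n) : ρ ^ j / j ! * ‖iteratedDeriv j (fun w => f w * g w) y‖ ≤
      ∑ i ∈ Finset.range (j + 1), A i * B (j - i) := by
    have hjn : (j : WithTop ℕ∞) ≤ n := by exact_mod_cast hj
    rw [iteratedDeriv_fun_mul (hf.of_le hjn) (hg.of_le hjn)]
    refine (mul_le_mul_of_nonneg_left (norm_sum_le _ _) (by positivity)).trans ?_
    rw [Finset.mul_sum]
    refine Finset.sum_le_sum fun i hi => ?_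
    have hij : i ≤ j := Finset.mem_range_succ_iff.1 hi
    have hfac : (j ! : ℝ) = j.choose i * i ! * (j - i)! := by
      exact_mod_cast (Nat.choose_mul_factorial_mul_factorial hij).symm
    have hchoose : (j.choose i : ℝ) ≠ 0 := by exact_mod_cast (Nat.choose_pos hij).ne'
    rw [mul_assoc, ← nsmul_eq_mul]
    grw [norm_nsmul_le, norm_mul_le]
    refine le_of_eq ?_
    simp only [A, B, hfac, ← pow_mul_pow_sub ρ hij]
    field_simp
  calc jetNorm n ρ (fun w => f w * g w) y
      ≤ ∑ j ∈ Finset.range (n + 1), ∑ i ∈ Finset.range (j + 1), A i * B (j - i) :=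
        Finset.sum_le_sum fun j hj => leibniz j (Finset.mem_range_succ_iff.1 hj)
    _ = ∑ i ∈ Finset.range (n + 1), ∑ k ∈ Finset.range (n + 1 - i), A i * B k :=
        Finset.sum_range_diag_flip (n + 1) fun i k => A i * B k
    _ ≤ ∑ i ∈ Finset.range (n + 1), ∑ k ∈ Finset.range (n + 1), A i * B k :=
        Finset.sum_le_sum fun i _ => Finset.sum_le_sum_of_subset_of_nonneg
          (Finset.range_mono (Nat.sub_le _ _)) fun k _ _ => mul_nonneg (hA0 i) (hB0 k)
    _ = _ := by rw [← Finset.sum_mul_sum]; rfl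

theorem jetNorm_inv_le {𝕜 : Type*} [NormedField 𝕜] [NormedAlgebra ℝ 𝕜] {n : ℕ} {ρ δ : ℝ}
    (hρ : 0 ≤ ρ) (hδ : 0 < δ) {f : ℝ → 𝕜} {y : ℝ} (hf : ContDiffAt ℝ n f y) (hy : δ ≤ ‖f y‖)
    (h : ∑ j ∈ Finset.range n, ρ ^ (j + 1) / (j + 1)! * ‖iteratedDeriv (j + 1) f y‖ ≤ δ / 2) :
    jetNorm n ρ (fun w => (f w)⁻¹) y ≤ 2 / δ := by
  have hy0 : f y ≠ 0 := norm_pos_iff.1 (hδ.trans_le hy)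
  have hinv : ContDiffAt ℝ n (fun w => (f w)⁻¹) y := hf.inv hy0
  set P := jetNorm n ρ (fun w => (f w)⁻¹) y
  have hP0 : 0 ≤ P := jetNorm_nonneg n hρ _ y
  have hsub : jetNorm n ρ (fun w => f y - f w) y ≤ δ / 2 := by
    refine le_of_eq_of_le ?_ h
    simp only [jetNorm_eq_norm_add_sum, sub_self, norm_zero, zero_add,
      iteratedDeriv_const_sub (Nat.succ_pos _), iteratedDeriv_neg, norm_neg]
  have hcongr : jetNorm n ρ (fun w => (f w)⁻¹) y =
      jetNorm n ρ (fun w => (f y)⁻¹ * (1 + (f w)⁻¹ * (f y - f w))) y := by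
    refine jetNorm_congr n ρ ?_
    filter_upwards [hf.continuousAt.eventually_ne hy0] with w hw
    field_simp
    ring
  have hmul : jetNorm n ρ (fun w => (f w)⁻¹ * (f y - f w)) y ≤ P * (δ / 2) :=
    (jetNorm_mul_le hρ hinv (contDiffAt_const.sub hf)).trans (by gcongr)
  -- The first terms of the Neumann series: `P ≤ ‖f y‖⁻¹ * (1 + P * (δ / 2))`.
  have hP : P ≤ δ⁻¹ * (1 + P * (δ / 2)) := by
    have hsmooth : ContDiffAt ℝ n (fun w => (f w)⁻¹ * (f y - f w)) y :=
      hinv.mul (contDiffAt_const.sub hf)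
    have hadd := jetNorm_add_le n hρ (f := fun _ => (1 : 𝕜)) contDiffAt_const hsmooth
    rw [jetNorm_const, norm_one] at hadd
    calc P ≤ jetNorm n ρ (fun _ => (f y)⁻¹) y *
          jetNorm n ρ (fun w => 1 + (f w)⁻¹ * (f y - f w)) y :=
        hcongr.trans_le (jetNorm_mul_le hρ contDiffAt_const (contDiffAt_const.add hsmooth))
      _ ≤ δ⁻¹ * (1 + P * (δ / 2)) := by
        rw [jetNorm_const, norm_inv]
        exact mul_le_mul (inv_anti₀ hδ hy) (hadd.trans (by gcongr)) (jetNorm_nonneg n hρ _ y)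
          (by positivity)
  have : δ⁻¹ * (1 + P * (δ / 2)) = 2 / δ / 2 + P / 2 := by field_simp
  linarith

theorem exists_sum_pow_mul_nnnorm_changeOrigin_le {𝕜 E F : Type*} [NontriviallyNormedField 𝕜]
    [NormedAddCommGroup E] [NormedSpace 𝕜 E] [NormedAddCommGroup F] [NormedSpace 𝕜 F]
    [CompleteSpace F] (p : FormalMultilinearSeries 𝕜 E F) {ρ : ℝ≥0}
    (hρ : (ρ + ρ : ENNReal) < p.radius) :
    ∃ C : ℝ≥0, ∀ z, ‖z‖₊ ≤ ρ → ∀ n,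
      ∑ j ∈ Finset.range n, ρ ^ j * ‖p.changeOrigin z j‖₊ ≤ C := by
  have hsum := p.changeOriginSeries_summable_aux₁ hρ
  refine ⟨_, fun z hz n => (Finset.sum_le_sum fun j _ => ?_).trans
    ((NNReal.summable_sigma.1 hsum).2.sum_le_tsum (Finset.range n) fun _ _ => zero_le)⟩
  have hzp : (‖z‖₊ : ENNReal) < p.radius :=
    (by exact_mod_cast hz.trans le_self_add : (‖z‖₊ : ENNReal) ≤ ρ + ρ).trans_lt hρ
  grw [p.nnnorm_changeOrigin_le j hzp]
  rw [← NNReal.tsum_mul_left]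
  refine Summable.tsum_le_tsum (fun s => ?_)
    ((p.changeOriginSeries_summable_aux₂ hzp j).mul_left _) ((NNReal.summable_sigma.1 hsum).1 j)
  rw [mul_comm]
  gcongr

theorem exists_eventually_jetNorm_le {E : Type*} [NormedAddCommGroup E] [NormedSpace ℝ E]
    [CompleteSpace E] {f : ℝ → E} {x₀ : ℝ} (hf : AnalyticAt ℝ f x₀) :
    ∃ ρ : ℝ, 0 < ρ ∧ ∃ C : ℝ, 0 ≤ C ∧ ∀ᶠ x in 𝓝 x₀, ∀ n, jetNorm n ρ f x ≤ C := by
  obtain ⟨p, R, hp⟩ := hf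
  obtain ⟨ρ, hρ0, hρR⟩ : ∃ ρ : ℝ≥0, 0 < ρ ∧ (ρ + ρ : ENNReal) < R := by
    obtain ⟨ρ, hρ0, hρR⟩ := ENNReal.lt_iff_exists_nnreal_btwn.1 (ENNReal.half_pos hp.r_pos.ne')
    exact ⟨ρ, by exact_mod_cast hρ0, by simpa using ENNReal.add_lt_add hρR hρR⟩
  obtain ⟨C, hC⟩ := exists_sum_pow_mul_nnnorm_changeOrigin_le p (hρR.trans_le hp.r_le)
  refine ⟨ρ, hρ0, C, C.2, ?_⟩
  filter_upwards [Metric.ball_mem_nhds x₀ (NNReal.coe_pos.2 hρ0)] with x hx n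
  have hz : ‖x - x₀‖₊ ≤ ρ := NNReal.coe_le_coe.1 (mem_ball_iff_norm.1 hx).le
  have hzR : (‖x - x₀‖₊ : ENNReal) < R :=
    (by exact_mod_cast hz.trans le_self_add : (‖x - x₀‖₊ : ENNReal) ≤ ρ + ρ).trans_lt hρR
  have hpx := hp.changeOrigin hzR
  rw [add_sub_cancel] at hpx
  have hsum := NNReal.coe_le_coe.2 (hC _ hz (n + 1))
  push_cast at hsum
  refine (Finset.sum_le_sum fun j _ => ?_).trans hsum
  have hderiv : ‖iteratedDeriv j f x‖ ≤ j ! * ‖p.changeOrigin (x - x₀) j‖ := by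
    rw [iteratedDeriv_eq_iteratedFDeriv, ← hpx.factorial_smul 1 j, ← Nat.cast_smul_eq_nsmul ℝ,
      norm_smul, RCLike.norm_natCast]
    gcongr
    simpa only [norm_one, Finset.prod_const_one, mul_one] using
      (p.changeOrigin (x - x₀) j).le_opNorm fun _ => (1 : ℝ)
  grw [hderiv]
  exact le_of_eq (by field_simp)

theorem exists_eventually_jetNorm_inv_sub_le {𝕜 : Type*} [NormedField 𝕜] [NormedAlgebra ℝ 𝕜]
    [CompleteSpace 𝕜] {f : ℝ → 𝕜} {x₀ : ℝ} {ζ₀ : 𝕜} (hf : AnalyticAt ℝ f x₀) (h : f x₀ ≠ ζ₀) :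
    ∃ ρ : ℝ, 0 < ρ ∧ ∃ Q : ℝ, 0 < Q ∧
      ∀ᶠ p in 𝓝 (x₀, ζ₀), ∀ n, jetNorm n ρ (fun v => (f v - p.2)⁻¹) p.1 ≤ Q := by
  obtain ⟨ρ, hρ, C, hC0, hC⟩ := exists_eventually_jetNorm_le hf
  set δ := ‖f x₀ - ζ₀‖ / 2
  have hδ : 0 < δ := half_pos (norm_pos_iff.2 (sub_ne_zero.2 h))
  obtain ⟨η, hη, hη1, hηC⟩ : ∃ η : ℝ, 0 < η ∧ η ≤ 1 ∧ η * C ≤ δ / 2 := by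
    refine ⟨min 1 (δ / 2 / (C + 1)), by positivity, min_le_left _ _, ?_⟩
    calc min 1 (δ / 2 / (C + 1)) * C ≤ δ / 2 / (C + 1) * (C + 1) := by
          gcongr
          · exact min_le_right _ _
          · exact (lt_add_one C).le
      _ = δ / 2 := by field_simp
  refine ⟨η * ρ, by positivity, 2 / δ, by positivity, ?_⟩
  have hcont : ContinuousAt (fun p : ℝ × 𝕜 => ‖f p.1 - p.2‖) (x₀, ζ₀) :=
    ((hf.continuousAt.comp (x := (x₀, ζ₀)) continuousAt_fst).sub continuousAt_snd).norm
  filter_upwards [continuousAt_fst.eventually hC,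
    continuousAt_fst.eventually hf.eventually_analyticAt,
    hcont.eventually_const_le (half_lt_self (norm_pos_iff.2 (sub_ne_zero.2 h)))]
    with ⟨x, ζ⟩ hCx hx hδx n
  refine jetNorm_inv_le (by positivity) hδ (hx.contDiffAt.sub contDiffAt_const) hδx ?_
  calc ∑ j ∈ Finset.range n, (η * ρ) ^ (j + 1) / (j + 1)! *
        ‖iteratedDeriv (j + 1) (fun v => f v - ζ) x‖
      ≤ ∑ j ∈ Finset.range n, η * (ρ ^ (j + 1) / (j + 1)! * ‖iteratedDeriv (j + 1) f x‖) := by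
        refine Finset.sum_le_sum fun j _ => ?_
        rw [iteratedDeriv_succ', deriv_sub_const_fun, ← iteratedDeriv_succ']
        grw [mul_pow, pow_le_of_le_one hη.le hη1 j.succ_ne_zero]
        exact le_of_eq (by ring)
    _ ≤ η * jetNorm n ρ f x := by
        rw [← Finset.mul_sum, jetNorm_eq_norm_add_sum]
        gcongr
        exact le_add_of_nonneg_left (norm_nonneg _)
    _ ≤ η * C := by grw [hCx n]
    _ ≤ δ / 2 := hηC

/-! ### Iterated integration by parts -/

/-- The functions `g`, `(q g)'`, `(q (q g)')'`, … produced by repeated integration by parts against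
an exponential `e` with `e' = e / q`. -/
def parts (q g : ℝ → ℂ) : ℕ → ℝ → ℂ
  | 0 => g
  | k + 1 => deriv fun w => q w * parts q g k w

theorem contDiffAt_deriv {E : Type*} [NormedAddCommGroup E] [NormedSpace ℝ E] {f : ℝ → E} {y : ℝ}
    (hf : ContDiffAt ℝ ∞ f y) : ContDiffAt ℝ ∞ (deriv f) y := by
  have hderiv := (hf.fderiv_right (m := ∞) le_rfl).clm_apply (contDiffAt_const (c := (1 : ℝ)))
  simpa only [fderiv_apply_one_eq_deriv] using hderiv

section Parts

variable {q g : ℝ → ℂ}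

theorem contDiffAt_parts {y : ℝ} (hq : ContDiffAt ℝ ∞ q y) (hg : ContDiffAt ℝ ∞ g y) (k : ℕ) :
    ContDiffAt ℝ ∞ (parts q g k) y := by
  induction k with
  | zero => exact hg
  | succ k ih => exact contDiffAt_deriv (hq.mul ih)

theorem jetNorm_parts_le {y : ℝ} (hq : ContDiffAt ℝ ∞ q y) (hg : ContDiffAt ℝ ∞ g y) {ρ σ Q : ℝ}
    (hσ : 0 < σ) (hQ : ∀ n, jetNorm n ρ q y ≤ Q) (k n : ℕ) {τ : ℝ} (hτ : 0 ≤ τ)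
    (hρ : τ + k * σ ≤ ρ) :
    jetNorm n τ (parts q g k) y ≤ (Q / σ) ^ k * jetNorm (n + k) (τ + k * σ) g y := by
  induction k generalizing n τ with
  | zero => simp [parts]
  | succ k ih =>
    push_cast at hρ ⊢
    have hτσ : 0 ≤ τ + σ := by positivity
    have hle : ((n + 1 : ℕ) : WithTop ℕ∞) ≤ ∞ := by exact_mod_cast le_top
    have hqτ : jetNorm (n + 1) (τ + σ) q y ≤ Q :=
      (jetNorm_mono _ hτσ (by nlinarith [k.cast_nonneg (α := ℝ)]) q y).trans (hQ _)
    calc jetNorm n τ (parts q g (k + 1)) y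
        ≤ (τ + σ - τ)⁻¹ * jetNorm (n + 1) (τ + σ) (fun w => q w * parts q g k w) y :=
          jetNorm_deriv_le n hτ (by linarith) _ y
      _ ≤ σ⁻¹ * (jetNorm (n + 1) (τ + σ) q y * jetNorm (n + 1) (τ + σ) (parts q g k) y) := by
          rw [add_sub_cancel_left]
          gcongr
          exact jetNorm_mul_le hτσ (hq.of_le hle) ((contDiffAt_parts hq hg k).of_le hle)
      _ ≤ σ⁻¹ * (Q * ((Q / σ) ^ k * jetNorm (n + 1 + k) (τ + σ + k * σ) g y)) := by
          gcongr
          · exact jetNorm_nonneg _ hτσ _ y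
          · exact (jetNorm_nonneg _ hτσ q y).trans hqτ
          · exact ih (n + 1) hτσ (by linarith)
      _ = (Q / σ) ^ (k + 1) * jetNorm (n + (k + 1)) (τ + (k + 1) * σ) g y := by
          rw [add_right_comm n, add_assoc n, show τ + σ + k * σ = τ + (k + 1) * σ by ring]
          ring

theorem norm_parts_le {y : ℝ} (hq : ContDiffAt ℝ ∞ q y) (hg : ContDiffAt ℝ ∞ g y) {ρ Q : ℝ}
    (hρ : 0 < ρ) (hQ : ∀ n, jetNorm n ρ q y ≤ Q) (k : ℕ) :
    ‖parts q g k y‖ ≤ (Q * k / ρ) ^ k * jetNorm k ρ g y := by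
  rcases Nat.eq_zero_or_pos k with rfl | hk
  · simp [parts, jetNorm_zero_left]
  · have hk' : (0 : ℝ) < k := Nat.cast_pos.2 hk
    have h := jetNorm_parts_le hq hg (div_pos hρ hk') hQ k 0 le_rfl
      (by rw [zero_add, mul_div_cancel₀ _ hk'.ne'])
    rwa [jetNorm_zero_left, zero_add, zero_add, mul_div_cancel₀ _ hk'.ne', div_div_eq_mul_div] at h

variable {e : ℝ → ℂ} {a b : ℝ}

theorem intervalIntegrable_mul_parts
    (hq : ∀ w ∈ Set.uIcc a b, ContDiffAt ℝ ∞ q w) (hg : ContDiff ℝ ∞ g)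
    (he : ∀ w ∈ Set.uIcc a b, HasDerivAt e (e w / q w) w) (k : ℕ) :
    IntervalIntegrable (fun w => e w * parts q g k w) volume a b :=
  ContinuousOn.intervalIntegrable fun w hw => ((he w hw).continuousAt.mul
    (contDiffAt_parts (hq w hw) hg.contDiffAt k).continuousAt).continuousWithinAt

theorem integral_mul_parts (hq : ∀ w ∈ Set.uIcc a b, ContDiffAt ℝ ∞ q w)
    (hq0 : ∀ w ∈ Set.uIcc a b, q w ≠ 0) (hg : ContDiff ℝ ∞ g)
    (he : ∀ w ∈ Set.uIcc a b, HasDerivAt e (e w / q w) w) (k : ℕ) :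
    ∫ w in a..b, e w * parts q g k w =
      e b * (q b * parts q g k b) - e a * (q a * parts q g k a) -
        ∫ w in a..b, e w * parts q g (k + 1) w := by
  have hderiv (w) (hw : w ∈ Set.uIcc a b) : HasDerivAt (fun w => e w * (q w * parts q g k w))
      (e w * parts q g k w + e w * parts q g (k + 1) w) w := by
    have hparts : HasDerivAt (fun w => q w * parts q g k w) (parts q g (k + 1) w) w :=
      (((hq w hw).mul (contDiffAt_parts (hq w hw) hg.contDiffAt k)).differentiableAt
        (by simp)).hasDerivAt
    refine ((he w hw).mul hparts).congr_deriv ?_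
    have := hq0 w hw
    field_simp
  have hint := intervalIntegrable_mul_parts hq hg he
  rw [← intervalIntegral.integral_eq_sub_of_hasDerivAt hderiv ((hint k).add (hint (k + 1))),
    intervalIntegral.integral_add (hint k) (hint (k + 1)), add_sub_cancel_right]

theorem norm_integral_mul_le_sum_add (hq : ∀ w ∈ Set.uIcc a b, ContDiffAt ℝ ∞ q w)
    (hq0 : ∀ w ∈ Set.uIcc a b, q w ≠ 0) (hg : ContDiff ℝ ∞ g)
    (he : ∀ w ∈ Set.uIcc a b, HasDerivAt e (e w / q w) w)
    (he1 : ∀ w ∈ Set.uIcc a b, ‖e w‖ ≤ 1) (N : ℕ) :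
    ‖∫ w in a..b, e w * g w‖ ≤
      (∑ k ∈ Finset.range N, (‖q b * parts q g k b‖ + ‖q a * parts q g k a‖)) +
        ‖∫ w in a..b, e w * parts q g N w‖ := by
  have hbound (w) (hw : w ∈ Set.uIcc a b) (ζ : ℂ) : ‖e w * ζ‖ ≤ ‖ζ‖ := by
    rw [norm_mul]
    exact mul_le_of_le_one_left (norm_nonneg ζ) (he1 w hw)
  induction N with
  | zero => simp [parts]
  | succ k ih =>
    refine ih.trans ?_
    rw [Finset.sum_range_succ, add_assoc, integral_mul_parts hq hq0 hg he k]
    grw [norm_sub_le, norm_sub_le, hbound b Set.right_mem_uIcc, hbound a Set.left_mem_uIcc]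

end Parts

/-! ### Decay of the elements of the space -/

theorem exp_mul_le_of_forall_pow_rpow_mul_le {t r w B D : ℝ} (ht : 0 < t) (hr : 0 < r) (hw : 0 ≤ w)
    (hB : 0 ≤ B) (hD : 0 ≤ D)
    (H : ∀ a : ℕ, (w ^ a) ^ t * B ≤ D * ((t / (2 * r)) ^ a * a !) ^ t) :
    Real.exp (r * w) * B ≤ 2 ^ t * D := by
  have hterm (a : ℕ) : (r / t * w) ^ a / a ! * B ^ t⁻¹ ≤ (1 / 2 : ℝ) ^ a * D ^ t⁻¹ := by
    have hroot := Real.rpow_le_rpow (by positivity) (H a) (inv_nonneg.2 ht.le)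
    rw [Real.mul_rpow (by positivity) hB, Real.mul_rpow hD (by positivity),
      Real.rpow_rpow_inv (by positivity) ht.ne', Real.rpow_rpow_inv (by positivity) ht.ne'] at hroot
    calc (r / t * w) ^ a / a ! * B ^ t⁻¹ = (r / t) ^ a / a ! * (w ^ a * B ^ t⁻¹) := by
          rw [mul_pow]; ring
      _ ≤ (r / t) ^ a / a ! * (D ^ t⁻¹ * ((t / (2 * r)) ^ a * a !)) := by gcongr
      _ = (r / t * (t / (2 * r))) ^ a * D ^ t⁻¹ := by rw [mul_pow]; field_simp
      _ = (1 / 2 : ℝ) ^ a * D ^ t⁻¹ := by congr 2; field_simp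
  have hsum : HasSum (fun a : ℕ => (r / t * w) ^ a / a !) (Real.exp (r / t * w)) := by
    rw [Real.exp_eq_exp_ℝ]
    exact NormedSpace.expSeries_div_hasSum_exp _
  have hle := hasSum_le hterm (hsum.mul_right (B ^ t⁻¹)) (hasSum_geometric_two.mul_right (D ^ t⁻¹))
  have hpow := Real.rpow_le_rpow (by positivity) hle ht.le
  rwa [Real.mul_rpow (by positivity) (by positivity), Real.mul_rpow (by positivity) (by positivity),
    Real.rpow_inv_rpow hB ht.ne', Real.rpow_inv_rpow hD ht.ne', ← Real.exp_mul, mul_right_comm,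
    div_mul_cancel₀ _ ht.ne'] at hpow

theorem exists_norm_iteratedDeriv_le {t s : ℝ} (ht : 0 < t) (ψ : Space t s) {r h : ℝ} (hr : 0 < r)
    (hh : 0 < h) : ∃ C : ℝ, 0 ≤ C ∧ ∀ (j : ℕ) (y : ℝ), ‖iteratedDeriv j (ψ : ℝ → ℂ) y‖ ≤
      C * (h ^ j * (j ! : ℝ) ^ s) * Real.exp (-(r * |y| ^ t⁻¹)) := by
  set κ := min h ((t / (2 * r)) ^ t)
  have hκ : 0 < κ := lt_min hh (by positivity)
  obtain ⟨C, hC0, hC⟩ := (bddAbove_ratio_iff t s hκ ψ).1 (ψ.2.2 κ hκ)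
  refine ⟨2 ^ t * C, by positivity, fun j y => ?_⟩
  have hexp := exp_mul_le_of_forall_pow_rpow_mul_le ht hr (w := |y| ^ t⁻¹)
    (B := ‖iteratedDeriv j (ψ : ℝ → ℂ) y‖) (D := C * (h ^ j * (j ! : ℝ) ^ s)) (by positivity)
    (norm_nonneg _) (by positivity) fun a => by
      calc ((|y| ^ t⁻¹) ^ a) ^ t * ‖iteratedDeriv j (ψ : ℝ → ℂ) y‖
          = |y| ^ a * ‖iteratedDeriv j (ψ : ℝ → ℂ) y‖ := by
            rw [← Real.rpow_pow_comm (by positivity), Real.rpow_inv_rpow (abs_nonneg y) ht.ne']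
        _ ≤ C * (κ ^ (a + j) * (a ! : ℝ) ^ t * (j ! : ℝ) ^ s) := hC a j y
        _ = C * (κ ^ j * (j ! : ℝ) ^ s) * (κ ^ a * (a ! : ℝ) ^ t) := by ring
        _ ≤ C * (h ^ j * (j ! : ℝ) ^ s) * (((t / (2 * r)) ^ t) ^ a * (a ! : ℝ) ^ t) := by
            gcongr
            · exact min_le_left _ _
            · exact min_le_right _ _
        _ = C * (h ^ j * (j ! : ℝ) ^ s) * ((t / (2 * r)) ^ a * a !) ^ t := by
            rw [Real.mul_rpow (by positivity) (by positivity), Real.rpow_pow_comm (by positivity)]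
  rw [Real.exp_neg, ← div_eq_mul_inv, le_div_iff₀ (Real.exp_pos _), mul_comm, mul_assoc]
  exact hexp

theorem exists_norm_coe_le {t s : ℝ} (ht : 0 < t) (ψ : Space t s) {r : ℝ} (hr : 0 < r) :
    ∃ C : ℝ, 0 ≤ C ∧ ∀ y : ℝ, ‖(ψ : ℝ → ℂ) y‖ ≤ C * Real.exp (-(r * |y| ^ t⁻¹)) := by
  obtain ⟨C, hC0, hC⟩ := exists_norm_iteratedDeriv_le ht ψ hr one_pos
  exact ⟨C, hC0, fun y => by simpa using hC 0 y⟩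

theorem integrable_coe {t s : ℝ} (ψ : Space t s) : Integrable (ψ : ℝ → ℂ) :=
  (integrable_inv_one_add_sq.const_mul _).mono' ψ.2.1.continuous.aestronglyMeasurable
    (.of_forall fun x => norm_le_inv ψ x)

theorem integrable_comp_abs {E : Type*} [NormedAddCommGroup E] {f : ℝ → E}
    (hf : IntegrableOn f (Set.Ioi 0)) : Integrable fun y => f |y| := by
  have hIoi : IntegrableOn (fun y => f |y|) (Set.Ioi 0) :=
    hf.congr_fun (fun y hy => by rw [abs_of_pos hy]) measurableSet_Ioi
  rw [← integrableOn_univ, ← Set.Iic_union_Ioi (a := (0 : ℝ)), integrableOn_union]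
  refine ⟨?_, hIoi⟩
  rw [integrableOn_Iic_iff_integrableOn_Iio, ← (Measure.measurePreserving_neg volume)
    |>.integrableOn_comp_preimage (Homeomorph.neg ℝ).measurableEmbedding]
  simpa [Function.comp_def] using hIoi

theorem integrable_exp_neg_mul_abs_rpow {p r : ℝ} (hp : 0 < p) (hr : 0 < r) :
    Integrable fun y : ℝ => Real.exp (-(r * |y| ^ p)) :=
  integrable_comp_abs (f := fun y => Real.exp (-(r * y ^ p))) <| by
    simpa using integrableOn_rpow_mul_exp_neg_mul_rpow (s := 0) (by norm_num) hp hr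

theorem mul_rpow_inv_le_of_rpow_mul_le {t μ ε z : ℝ} (ht : 0 < t) (hμ : 0 ≤ μ) (hε : 0 ≤ ε)
    (h : μ ^ t * ε ≤ z) : μ * ε ^ t⁻¹ ≤ z ^ t⁻¹ := by
  rw [← Real.rpow_rpow_inv hμ ht.ne', ← Real.mul_rpow (by positivity) hε]
  exact Real.rpow_le_rpow (by positivity) h (inv_nonneg.2 ht.le)

theorem exists_setIntegral_norm_le {t s : ℝ} (ht : 0 < t) (ψ : Space t s) {r ε : ℝ} (hr : 0 < r)
    (hε : 0 < ε) : ∃ C : ℝ, 0 ≤ C ∧ ∀ μ : ℝ, 0 < μ →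
      ∫ y in (Set.Ioc (-(μ ^ t * ε)) (μ ^ t * ε))ᶜ, ‖(ψ : ℝ → ℂ) y‖ ≤ C * Real.exp (-(r * μ)) := by
  set κ := ε ^ t⁻¹
  have hκ : 0 < κ := by positivity
  obtain ⟨C, hC0, hC⟩ := exists_norm_coe_le ht ψ (r := r / κ + 1) (by positivity)
  have hint := integrable_exp_neg_mul_abs_rpow (inv_pos.2 ht) one_pos
  refine ⟨C * ∫ y : ℝ, Real.exp (-(1 * |y| ^ t⁻¹)), by positivity, fun μ hμ => ?_⟩
  set S := (Set.Ioc (-(μ ^ t * ε)) (μ ^ t * ε))ᶜ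
  have hint' := hint.const_mul (C * Real.exp (-(r * μ)))
  have hbound (y) (hy : y ∈ S) :
      ‖(ψ : ℝ → ℂ) y‖ ≤ C * Real.exp (-(r * μ)) * Real.exp (-(1 * |y| ^ t⁻¹)) := by
    have hy' : μ ^ t * ε ≤ |y| :=
      not_lt.1 fun hlt => hy ⟨(abs_lt.1 hlt).1, (abs_lt.1 hlt).2.le⟩
    have hμy : r / κ * (μ * κ) ≤ r / κ * |y| ^ t⁻¹ := by
      gcongr
      exact mul_rpow_inv_le_of_rpow_mul_le ht hμ.le hε.le hy'
    refine (hC y).trans ?_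
    rw [mul_assoc C, ← Real.exp_add]
    gcongr
    have : r / κ * (μ * κ) = r * μ := by field_simp
    linarith
  calc ∫ y in S, ‖(ψ : ℝ → ℂ) y‖
      ≤ ∫ y in S, C * Real.exp (-(r * μ)) * Real.exp (-(1 * |y| ^ t⁻¹)) :=
        setIntegral_mono_on (integrable_coe ψ).norm.integrableOn hint'.integrableOn
          measurableSet_Ioc.compl hbound
    _ ≤ ∫ y, C * Real.exp (-(r * μ)) * Real.exp (-(1 * |y| ^ t⁻¹)) :=
        setIntegral_le_integral hint' (.of_forall fun y => by positivity)
    _ = _ := by rw [integral_const_mul]; ring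

/-! ### Rapidly oscillating integrals -/

theorem norm_iteratedDeriv_conj (f : ℝ → ℂ) (y : ℝ) (j : ℕ) :
    ‖iteratedDeriv j (fun w => (starRingEnd ℂ) (f w)) y‖ = ‖iteratedDeriv j f y‖ := by
  rw [← norm_iteratedFDeriv_eq_norm_iteratedDeriv, ← norm_iteratedFDeriv_eq_norm_iteratedDeriv]
  exact Complex.conjLIE.norm_iteratedFDeriv_comp_left f y j

theorem contDiff_conj_coe {t s : ℝ} (ψ : Space t s) :
    ContDiff ℝ ∞ fun y => (starRingEnd ℂ) ((ψ : ℝ → ℂ) y) :=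
  Complex.conjCLE.contDiff.comp ψ.2.1

theorem factorial_rpow_le {s μ : ℝ} (hs : 0 ≤ s) {j : ℕ} (hj : j ≤ μ) :
    (j ! : ℝ) ^ s ≤ (μ ^ s) ^ j := by
  have hμ : 0 ≤ μ := j.cast_nonneg.trans hj
  rw [Real.rpow_pow_comm hμ]
  gcongr
  calc (j ! : ℝ) ≤ (j : ℝ) ^ j := by exact_mod_cast Nat.factorial_le_pow j
    _ ≤ μ ^ j := by gcongr

/-- The factor `(Q k / ρ) ^ k` lost in `k ≤ μ` integrations by parts, for `Q` and `ρ` as they occur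
at the scale `μ`, is outweighed by the smallness of `h`. -/
theorem pow_mul_sum_le {t s h μ ρ Q : ℝ} (hs : 1 ≤ s) (hh : 0 < h) (hμ : 0 < μ) (hρ : 0 < ρ)
    (hQ : 0 ≤ Q) (hscale : 1 ≤ ρ * h * μ ^ (t + s - 1)) {k : ℕ} (hk : k ≤ μ) :
    (Q * μ ^ (-s) * k / (ρ * μ ^ t)) ^ k *
      ∑ j ∈ Finset.range (k + 1), (ρ * μ ^ t) ^ j * h ^ j * (j ! : ℝ) ^ (s - 1) ≤
      (2 * Q * h) ^ k := by
  have hterm (j : ℕ) (hj : j ∈ Finset.range (k + 1)) :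
      (ρ * μ ^ t) ^ j * h ^ j * (j ! : ℝ) ^ (s - 1) ≤ (ρ * h * μ ^ (t + s - 1)) ^ k := by
    have hjk : j ≤ k := Finset.mem_range_succ_iff.1 hj
    calc (ρ * μ ^ t) ^ j * h ^ j * (j ! : ℝ) ^ (s - 1)
        ≤ (ρ * μ ^ t) ^ j * h ^ j * (μ ^ (s - 1)) ^ j := by
          gcongr
          exact factorial_rpow_le (sub_nonneg.2 hs) ((Nat.cast_le.2 hjk).trans hk)
      _ = (ρ * h * μ ^ (t + s - 1)) ^ j := by
          rw [← mul_pow, ← mul_pow, add_sub_assoc, Real.rpow_add hμ]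
          ring
      _ ≤ (ρ * h * μ ^ (t + s - 1)) ^ k := pow_le_pow_right₀ hscale hjk
  have htwo : ((k + 1 : ℕ) : ℝ) ≤ 2 ^ k := by exact_mod_cast Nat.lt_two_pow_self
  calc _ ≤ (Q * μ ^ (-s) * μ / (ρ * μ ^ t)) ^ k * (2 ^ k * (ρ * h * μ ^ (t + s - 1)) ^ k) := by
        gcongr
        refine (Finset.sum_le_card_nsmul _ _ _ hterm).trans ?_
        rw [Finset.card_range, nsmul_eq_mul]
        gcongr
    _ = (2 * Q * h) ^ k := by
        rw [← mul_pow, ← mul_pow, add_sub_assoc, Real.rpow_add hμ, Real.rpow_sub_one hμ.ne',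
          Real.rpow_neg hμ.le]
        congr 1
        field_simp

theorem exists_norm_parts_le {t s : ℝ} (ht : 0 < t) (hs : 1 ≤ s) (ψ : Space t s) {r R ρ Q : ℝ}
    (hR : 0 < R) (hρ : 0 < ρ) (hQ : 0 < Q) :
    ∃ C : ℝ, 0 ≤ C ∧ ∀ᶠ μ in atTop, ∀ (q : ℝ → ℂ) (y : ℝ), ContDiffAt ℝ ∞ q y →
      (∀ n, jetNorm n (ρ * μ ^ t) q y ≤ Q * μ ^ (-s)) → ∀ k : ℕ, k ≤ μ →
      ‖parts q (fun w => (starRingEnd ℂ) ((ψ : ℝ → ℂ) w)) k y‖ ≤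
        C * Real.exp (-(R * |y| ^ t⁻¹)) * Real.exp (-r) ^ k := by
  set h := Real.exp (-r) / (2 * Q)
  have hh : 0 < h := by positivity
  obtain ⟨C, hC0, hC⟩ := exists_norm_iteratedDeriv_le ht ψ hR hh
  refine ⟨C, hC0, ?_⟩
  have hscale : Tendsto (fun μ : ℝ => ρ * h * μ ^ (t + s - 1)) atTop atTop :=
    (tendsto_rpow_atTop (by linarith)).const_mul_atTop (by positivity)
  filter_upwards [eventually_gt_atTop 0, hscale.eventually_ge_atTop 1]
    with μ hμ hscaleμ q y hq hqQ k hk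
  set g := fun w => (starRingEnd ℂ) ((ψ : ℝ → ℂ) w)
  have hjet : jetNorm k (ρ * μ ^ t) g y ≤ C * Real.exp (-(R * |y| ^ t⁻¹)) *
      ∑ j ∈ Finset.range (k + 1), (ρ * μ ^ t) ^ j * h ^ j * (j ! : ℝ) ^ (s - 1) := by
    rw [jetNorm, Finset.mul_sum]
    refine Finset.sum_le_sum fun j _ => ?_
    rw [norm_iteratedDeriv_conj]
    grw [hC j y]
    rw [Real.rpow_sub_one (by positivity)]
    exact le_of_eq (by ring)
  calc ‖parts q g k y‖
      ≤ (Q * μ ^ (-s) * k / (ρ * μ ^ t)) ^ k * jetNorm k (ρ * μ ^ t) g y :=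
        norm_parts_le hq (contDiff_conj_coe ψ).contDiffAt (by positivity) hqQ k
    _ ≤ C * Real.exp (-(R * |y| ^ t⁻¹)) * ((Q * μ ^ (-s) * k / (ρ * μ ^ t)) ^ k *
          ∑ j ∈ Finset.range (k + 1), (ρ * μ ^ t) ^ j * h ^ j * (j ! : ℝ) ^ (s - 1)) := by
        rw [mul_left_comm]
        gcongr
    _ ≤ C * Real.exp (-(R * |y| ^ t⁻¹)) * Real.exp (-r) ^ k := by
        grw [pow_mul_sum_le hs hh hμ hρ hQ.le hscaleμ hk]
        rw [mul_div_cancel₀ _ (by positivity)]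

/-- The phase of the oscillating factor `e` is not stationary at `y`: `e' = e / q` there, and all
jets of `q` are bounded by `Q` in the norm of radius `P`. -/
structure IsNonstationaryAt (e q : ℝ → ℂ) (P Q y : ℝ) : Prop where
  norm_le_one : ‖e y‖ ≤ 1
  hasDerivAt : HasDerivAt e (e y / q y) y
  contDiffAt : ContDiffAt ℝ ∞ q y
  ne_zero : q y ≠ 0
  jetNorm_le : ∀ n, jetNorm n P q y ≤ Q

theorem IsNonstationaryAt.norm_le {e q : ℝ → ℂ} {P Q y : ℝ} (h : IsNonstationaryAt e q P Q y) :
    ‖q y‖ ≤ Q := by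
  simpa only [jetNorm_zero_left] using h.jetNorm_le 0

section NonstationaryIntegral

variable {t s : ℝ} (ht : 0 < t) (hs : 1 ≤ s) (ψ : Space t s) {ρ Q ε r : ℝ} (hρ : 0 < ρ)
  (hQ : 0 < Q) (hε : 0 < ε) (hr : 0 < r)

include ht hs hρ hQ hr

include hε in
theorem exists_norm_boundary_le : ∃ C : ℝ, 0 ≤ C ∧ ∀ᶠ μ in atTop, ∀ (e q : ℝ → ℂ) (y : ℝ),
    |y| = μ ^ t * ε → IsNonstationaryAt e q (ρ * μ ^ t) (Q * μ ^ (-s)) y → ∀ k : ℕ, k ≤ μ →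
      ‖q y * parts q (fun w => (starRingEnd ℂ) ((ψ : ℝ → ℂ) w)) k y‖ ≤
        C * Real.exp (-(r * μ)) := by
  obtain ⟨C, hC0, hC⟩ :=
    exists_norm_parts_le ht hs ψ (r := 0) (R := r / ε ^ t⁻¹) (by positivity) hρ hQ
  refine ⟨Q * C, by positivity, ?_⟩
  filter_upwards [hC, eventually_ge_atTop 1] with μ hCμ hμ e q y hy hns k hk
  have hparts := hCμ q y hns.contDiffAt hns.jetNorm_le k hk
  have hexp : r / ε ^ t⁻¹ * |y| ^ t⁻¹ = r * μ := by
    rw [hy, Real.mul_rpow (by positivity) hε.le, Real.rpow_rpow_inv (by positivity) ht.ne']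
    field_simp
  rw [hexp, neg_zero, Real.exp_zero, one_pow, mul_one] at hparts
  have hq : ‖q y‖ ≤ Q := hns.norm_le.trans
    (mul_le_of_le_one_right hQ.le (Real.rpow_le_one_of_one_le_of_nonpos hμ (by linarith)))
  rw [norm_mul, mul_assoc]
  gcongr

theorem exists_norm_integral_mul_parts_le : ∃ C : ℝ, 0 ≤ C ∧ ∀ᶠ μ in atTop, ∀ (e q : ℝ → ℂ) (A : ℝ),
    (∀ y ∈ Set.uIcc (-A) A, IsNonstationaryAt e q (ρ * μ ^ t) (Q * μ ^ (-s)) y) →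
      ‖∫ y in -A..A, e y * parts q (fun w => (starRingEnd ℂ) ((ψ : ℝ → ℂ) w)) ⌊μ⌋₊ y‖ ≤
        C * Real.exp (-(r * μ)) := by
  obtain ⟨C, hC0, hC⟩ := exists_norm_parts_le ht hs ψ (r := r) one_pos hρ hQ
  have hint := integrable_exp_neg_mul_abs_rpow (inv_pos.2 ht) one_pos
  set J := ∫ y : ℝ, Real.exp (-(1 * |y| ^ t⁻¹))
  refine ⟨C * Real.exp r * J, by positivity, ?_⟩
  filter_upwards [hC, eventually_ge_atTop 0] with μ hCμ hμ e q A hns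
  have hfloor : Real.exp (-r) ^ ⌊μ⌋₊ ≤ Real.exp r * Real.exp (-(r * μ)) := by
    rw [← Real.exp_nat_mul, ← Real.exp_add, Real.exp_le_exp]
    nlinarith [Nat.lt_floor_add_one μ]
  have hbound (y) (hy : y ∈ Set.uIoc (-A) A) :
      ‖e y * parts q (fun w => (starRingEnd ℂ) ((ψ : ℝ → ℂ) w)) ⌊μ⌋₊ y‖ ≤
        C * Real.exp r * Real.exp (-(r * μ)) * Real.exp (-(1 * |y| ^ t⁻¹)) := by
    have hy' := hns y (Set.uIoc_subset_uIcc hy)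
    grw [norm_mul, hy'.norm_le_one, one_mul,
      hCμ q y hy'.contDiffAt hy'.jetNorm_le _ (Nat.floor_le hμ), hfloor]
    exact le_of_eq (by ring)
  have hint' := hint.const_mul (C * Real.exp r * Real.exp (-(r * μ)))
  rw [intervalIntegral.norm_intervalIntegral_eq]
  calc _ ≤ ∫ y in Set.uIoc (-A) A,
        C * Real.exp r * Real.exp (-(r * μ)) * Real.exp (-(1 * |y| ^ t⁻¹)) :=
        norm_integral_le_of_norm_le hint'.integrableOn
          ((ae_restrict_mem measurableSet_uIoc).mono hbound)
    _ ≤ ∫ y, C * Real.exp r * Real.exp (-(r * μ)) * Real.exp (-(1 * |y| ^ t⁻¹)) :=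
        setIntegral_le_integral hint' (.of_forall fun y => by positivity)
    _ = _ := by
        rw [integral_const_mul]
        ring

include hε

theorem exists_norm_intervalIntegral_le : ∃ C : ℝ, 0 ≤ C ∧ ∀ᶠ μ in atTop, ∀ e q : ℝ → ℂ,
    (∀ y ∈ Set.uIcc (-(μ ^ t * ε)) (μ ^ t * ε),
      IsNonstationaryAt e q (ρ * μ ^ t) (Q * μ ^ (-s)) y) →
      ‖∫ y in -(μ ^ t * ε)..(μ ^ t * ε), e y * (starRingEnd ℂ) ((ψ : ℝ → ℂ) y)‖ ≤
        C * Real.exp (-(r * μ)) := by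
  obtain ⟨B, hB0, hB⟩ :=
    exists_norm_boundary_le ht hs ψ hρ hQ hε (r := r + 1) (by positivity)
  obtain ⟨C, hC0, hC⟩ := exists_norm_integral_mul_parts_le ht hs ψ hρ hQ hr
  refine ⟨2 * B + C, by positivity, ?_⟩
  filter_upwards [hB, hC, eventually_gt_atTop 0] with μ hBμ hCμ hμ e q hns
  set A := μ ^ t * ε
  have hA : 0 ≤ A := by positivity
  have hNμ : (⌊μ⌋₊ : ℝ) ≤ μ := Nat.floor_le hμ.le
  have hboundary : ∑ k ∈ Finset.range ⌊μ⌋₊,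
      (‖q A * parts q (fun w => (starRingEnd ℂ) ((ψ : ℝ → ℂ) w)) k A‖ +
        ‖q (-A) * parts q (fun w => (starRingEnd ℂ) ((ψ : ℝ → ℂ) w)) k (-A)‖) ≤
      2 * B * Real.exp (-(r * μ)) :=
    calc _ ≤ ⌊μ⌋₊ • (2 * (B * Real.exp (-((r + 1) * μ)))) := by
          refine (Finset.sum_le_card_nsmul _ _ _ fun k hk => ?_).trans_eq
            (by rw [Finset.card_range])
          have hkμ : (k : ℝ) ≤ μ := (Nat.cast_le.2 (Finset.mem_range.1 hk).le).trans hNμ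
          rw [two_mul]
          exact add_le_add
            (hBμ e q A (abs_of_nonneg hA) (hns A Set.right_mem_uIcc) k hkμ)
            (hBμ e q (-A) (by rw [abs_neg, abs_of_nonneg hA]) (hns (-A) Set.left_mem_uIcc) k hkμ)
      _ ≤ Real.exp μ * (2 * (B * Real.exp (-((r + 1) * μ)))) := by
          rw [nsmul_eq_mul]
          gcongr
          linarith [Real.add_one_le_exp μ]
      _ = 2 * B * Real.exp (-(r * μ)) := by
          rw [show -(r * μ) = μ + -((r + 1) * μ) by ring, Real.exp_add]
          ring
  calc _ ≤ _ + _ := norm_integral_mul_le_sum_add (fun y hy => (hns y hy).contDiffAt)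
        (fun y hy => (hns y hy).ne_zero) (contDiff_conj_coe ψ) (fun y hy => (hns y hy).hasDerivAt)
        (fun y hy => (hns y hy).norm_le_one) ⌊μ⌋₊
    _ ≤ 2 * B * Real.exp (-(r * μ)) + C * Real.exp (-(r * μ)) :=
        add_le_add hboundary (hCμ e q A hns)
    _ = (2 * B + C) * Real.exp (-(r * μ)) := by ring

end NonstationaryIntegral

/-! ### The short-time Fourier transform of an oscillation -/

/-- The normalizing constant `(2π)^{-1/2}` of `stft`. -/
def stftConst : ℝ := (2 * Real.pi) ^ (-(1 / 2) : ℝ)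

theorem stftConst_pos : 0 < stftConst := Real.rpow_pos_of_pos (by positivity) _

/-- `z` has an open neighbourhood as in the definition of `waveFrontSet`, whose points are the
`z ≠ 0` for which this fails. -/
def DecaysNear {t s : ℝ} (ht : 0 < t) (hs : 0 < s) (ψ : Space t s) (u : Ultradistribution t s)
    (z : ℝ × ℝ) : Prop :=
  ∃ U : Set (ℝ × ℝ), IsOpen U ∧ (0 : ℝ × ℝ) ∉ U ∧ z ∈ U ∧
    ∀ r : ℝ, 0 < r → ∃ C : ℝ, ∀ μ : ℝ, 0 < μ → ∀ p ∈ U,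
      Real.exp (r * μ) * ‖stft ht hs ψ u (μ ^ t * p.1) (μ ^ s * p.2)‖ ≤ C

theorem mem_waveFrontSet_iff {t s : ℝ} {ht : 0 < t} {hs : 0 < s} {ψ : Space t s}
    {u : Ultradistribution t s} {z : ℝ × ℝ} :
    z ∈ waveFrontSet ht hs ψ u ↔ z ≠ 0 ∧ ¬ DecaysNear ht hs ψ u z := Iff.rfl

/-- The Fourier transform in the angular normalization, in which `ξ` is dual to `y` without the
factor `2π` of `𝓕`. -/
def angularFourier (f : ℝ → ℂ) (ξ : ℝ) : ℂ :=
  ∫ y : ℝ, Complex.exp (-(Complex.I * (ξ * y : ℝ))) * f y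

/-- The function whose Fourier transform is, up to a constant, the short-time Fourier transform
`V_ψ u (x, ·)` of the oscillation `u = e ^ (i θ)`. -/
def windowedOscillation {t s : ℝ} (θ : ℝ → ℝ) (ψ : Space t s) (x y : ℝ) : ℂ :=
  Complex.exp (Complex.I * θ y) * (starRingEnd ℂ) ((ψ : ℝ → ℂ) (y - x))

section Oscillation

variable {t s : ℝ} (ht : 0 < t) (hs : 0 < s) (ψ : Space t s) {θ : ℝ → ℝ} (hθ : Continuous θ)

theorem norm_stft_oscillation (x ξ : ℝ) :
    ‖stft ht hs ψ (ofFunction t s (oscillation θ hθ)) x ξ‖ =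
      stftConst * ‖angularFourier (windowedOscillation θ ψ x) ξ‖ := by
  have hstft : stft ht hs ψ (ofFunction t s (oscillation θ hθ)) x ξ = stftConst *
      ∫ y : ℝ, Complex.exp (Complex.I * θ y) * (starRingEnd ℂ)
        (Complex.exp (Complex.I * (y * ξ : ℝ)) * (ψ : ℝ → ℂ) (y - x)) := rfl
  rw [hstft, norm_mul, Complex.norm_real, Real.norm_of_nonneg stftConst_pos.le]
  congr 3 with y
  rw [windowedOscillation, map_mul, ← Complex.exp_conj, map_mul, Complex.conj_I,
    Complex.conj_ofReal, mul_left_comm, neg_mul, mul_comm y]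

theorem norm_stft_oscillation_eq_shift (x ξ : ℝ) :
    ‖stft ht hs ψ (ofFunction t s (oscillation θ hθ)) x ξ‖ = stftConst *
      ‖∫ y : ℝ, Complex.exp (Complex.I * (θ (x + y) - ξ * y : ℝ)) *
        (starRingEnd ℂ) ((ψ : ℝ → ℂ) y)‖ := by
  have hfactor (y : ℝ) : Complex.exp (-(Complex.I * (ξ * (x + y) : ℝ))) *
      windowedOscillation θ ψ x (x + y) = Complex.exp ((-(ξ * x) : ℝ) * Complex.I) *
        (Complex.exp (Complex.I * (θ (x + y) - ξ * y : ℝ)) *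
          (starRingEnd ℂ) ((ψ : ℝ → ℂ) y)) := by
    rw [windowedOscillation, add_sub_cancel_left, ← mul_assoc, ← mul_assoc, ← Complex.exp_add,
      ← Complex.exp_add]
    congr 2
    push_cast
    ring
  rw [norm_stft_oscillation, angularFourier, ← integral_add_left_eq_self _ x]
  simp_rw [hfactor]
  rw [integral_const_mul, norm_mul, Complex.norm_exp_ofReal_mul_I, one_mul]

theorem norm_stft_oscillation_le (x ξ : ℝ) :
    ‖stft ht hs ψ (ofFunction t s (oscillation θ hθ)) x ξ‖ ≤
      stftConst * ∫ y : ℝ, ‖(ψ : ℝ → ℂ) y‖ := by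
  rw [norm_stft_oscillation_eq_shift]
  gcongr
  · exact stftConst_pos.le
  refine (norm_integral_le_integral_norm _).trans_eq (integral_congr_ae (.of_forall fun y => ?_))
  simp only [norm_mul, Complex.norm_exp_I_mul_ofReal, one_mul, RCLike.norm_conj]

theorem decaysNear_oscillation {z : ℝ × ℝ} (hz : z ≠ 0) {V : Set (ℝ × ℝ)} (hV : V ∈ 𝓝 z)
    (h : ∀ r : ℝ, 0 < r → ∃ C : ℝ, ∀ᶠ μ : ℝ in atTop, ∀ p ∈ V,
      ‖stft ht hs ψ (ofFunction t s (oscillation θ hθ)) (μ ^ t * p.1) (μ ^ s * p.2)‖ ≤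
        C * Real.exp (-(r * μ))) :
    DecaysNear ht hs ψ (ofFunction t s (oscillation θ hθ)) z := by
  refine ⟨interior V \ {0}, isOpen_interior.sdiff isClosed_singleton, fun h0 => h0.2 rfl,
    ⟨mem_interior_iff_mem_nhds.2 hV, hz⟩, fun r hr => ?_⟩
  obtain ⟨C, hC⟩ := h r hr
  obtain ⟨M, hM⟩ := eventually_atTop.1 hC
  refine ⟨max C (Real.exp (r * M) * (stftConst * ∫ y : ℝ, ‖(ψ : ℝ → ℂ) y‖)),
    fun μ _ p hp => ?_⟩
  rcases le_total M μ with hμ | hμ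
  · refine le_max_of_le_left ?_
    rw [← le_div_iff₀' (Real.exp_pos _), div_eq_mul_inv, ← Real.exp_neg]
    exact hM μ hμ p (interior_subset hp.1)
  · refine le_max_of_le_right ?_
    gcongr
    exact norm_stft_oscillation_le ht hs ψ hθ _ _

end Oscillation

/-! ### Decay where the phase is not stationary -/

theorem exists_norm_integral_le {t s : ℝ} (ht : 0 < t) (hs : 1 ≤ s) (ψ : Space t s)
    {ρ Q ε r : ℝ} (hρ : 0 < ρ) (hQ : 0 < Q) (hε : 0 < ε) (hr : 0 < r) :
    ∃ C : ℝ, ∀ᶠ μ in atTop, ∀ e q : ℝ → ℂ, Continuous e → (∀ y, ‖e y‖ ≤ 1) →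
      (∀ y, |y| ≤ μ ^ t * ε → IsNonstationaryAt e q (ρ * μ ^ t) (Q * μ ^ (-s)) y) →
        ‖∫ y, e y * (starRingEnd ℂ) ((ψ : ℝ → ℂ) y)‖ ≤ C * Real.exp (-(r * μ)) := by
  obtain ⟨C, -, hC⟩ := exists_norm_intervalIntegral_le ht hs ψ hρ hQ hε hr
  obtain ⟨T, -, hT⟩ := exists_setIntegral_norm_le ht ψ hr hε
  refine ⟨C + T, ?_⟩
  filter_upwards [hC, eventually_gt_atTop 0] with μ hCμ hμ e q he he1 hns
  set A := μ ^ t * ε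
  have hA : 0 ≤ A := by positivity
  have hle (y : ℝ) : ‖e y * (starRingEnd ℂ) ((ψ : ℝ → ℂ) y)‖ ≤ ‖(ψ : ℝ → ℂ) y‖ := by
    rw [norm_mul, RCLike.norm_conj]
    exact mul_le_of_le_one_left (norm_nonneg _) (he1 y)
  have hint : Integrable fun y => e y * (starRingEnd ℂ) ((ψ : ℝ → ℂ) y) :=
    (integrable_coe ψ).norm.mono'
      (he.mul (contDiff_conj_coe ψ).continuous).aestronglyMeasurable (.of_forall hle)
  rw [← integral_add_compl measurableSet_Ioc hint (s := Set.Ioc (-A) A),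
    ← intervalIntegral.integral_of_le (by linarith), add_mul]
  refine norm_add_le_of_le (hCμ e q fun y hy => hns y ?_) ?_
  · rwa [Set.uIcc_of_le (by linarith), Set.mem_Icc, ← abs_le] at hy
  · exact (norm_integral_le_of_norm_le (integrable_coe ψ).norm.integrableOn
      (.of_forall hle)).trans (hT μ hμ)

section Homogeneous

variable {θ : ℝ → ℝ} {t s : ℝ} (hhom : ∀ μ : ℝ, 0 < μ → ∀ v, θ (μ ^ t * v) = μ ^ (s + t) * θ v)

include hhom

theorem hasDerivAt_scaled_phase {x ξ y μ : ℝ} (hμ : 0 < μ)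
    (hθ : DifferentiableAt ℝ θ (x + μ ^ (-t) * y)) :
    HasDerivAt (fun y => θ (μ ^ t * x + y) - μ ^ s * ξ * y)
      (μ ^ s * (deriv θ (x + μ ^ (-t) * y) - ξ)) y := by
  have hinv : μ ^ (-t) * μ ^ t = 1 := by rw [← Real.rpow_add hμ, neg_add_cancel, Real.rpow_zero]
  have hphase : (fun y => θ (μ ^ t * x + y) - μ ^ s * ξ * y) =
      fun y => μ ^ (s + t) * θ (x + μ ^ (-t) * y) - μ ^ s * ξ * y := by
    funext y
    rw [← hhom μ hμ, mul_add, ← mul_assoc, mul_comm (μ ^ t) (μ ^ (-t)), hinv, one_mul]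
  have hshift : HasDerivAt (fun y => x + μ ^ (-t) * y) (μ ^ (-t)) y := by
    simpa using ((hasDerivAt_id y).const_mul (μ ^ (-t))).const_add x
  rw [hphase]
  refine (((hθ.hasDerivAt.comp y hshift).const_mul (μ ^ (s + t))).sub
    ((hasDerivAt_id y).const_mul (μ ^ s * ξ))).congr_deriv ?_
  rw [Real.rpow_add hμ]
  linear_combination μ ^ s * deriv θ (x + μ ^ (-t) * y) * hinv

theorem isNonstationaryAt_exp {ρ Q x ξ y μ : ℝ} (hρ : 0 ≤ ρ) (hμ : 0 < μ)
    (hθ : AnalyticAt ℝ θ (x + μ ^ (-t) * y)) (hne : deriv θ (x + μ ^ (-t) * y) ≠ ξ)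
    (hjet : ∀ n, jetNorm n ρ (fun v => (Complex.I * deriv θ v - Complex.I * ξ)⁻¹)
      (x + μ ^ (-t) * y) ≤ Q) :
    IsNonstationaryAt (fun y => Complex.exp (Complex.I * (θ (μ ^ t * x + y) - μ ^ s * ξ * y : ℝ)))
      (fun y => (μ ^ (-s) : ℝ) * (Complex.I * deriv θ (x + μ ^ (-t) * y) - Complex.I * ξ)⁻¹)
      (ρ * μ ^ t) (Q * μ ^ (-s)) y := by
  have hne' : Complex.I * deriv θ (x + μ ^ (-t) * y) - Complex.I * ξ ≠ 0 := by
    rw [← mul_sub]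
    exact mul_ne_zero Complex.I_ne_zero (by exact_mod_cast sub_ne_zero.2 hne)
  have hcd : ContDiffAt ℝ ∞ (fun v => (Complex.I * deriv θ v - Complex.I * ξ)⁻¹)
      (x + μ ^ (-t) * y) :=
    ((contDiffAt_const.mul (Complex.ofRealCLM.contDiff.contDiffAt.comp _
      hθ.deriv.contDiffAt)).sub contDiffAt_const).inv hne'
  have hcd' : ContDiffAt ℝ ∞
      (fun y => (Complex.I * deriv θ (x + μ ^ (-t) * y) - Complex.I * ξ)⁻¹) y :=
    hcd.comp (f := fun y => x + μ ^ (-t) * y) y (by fun_prop)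
  refine ⟨(Complex.norm_exp_I_mul_ofReal _).le, ?_, contDiffAt_const.mul hcd', ?_, fun n => ?_⟩
  · have hderiv := hasDerivAt_scaled_phase hhom (ξ := ξ) hμ hθ.differentiableAt
    refine ((hderiv.ofReal_comp.const_mul Complex.I).cexp).congr_deriv ?_
    rw [Real.rpow_neg hμ.le s, Complex.ofReal_inv, ← mul_inv, div_inv_eq_mul]
    push_cast
    ring
  · exact mul_ne_zero (by exact_mod_cast (Real.rpow_pos_of_pos hμ _).ne') (inv_ne_zero hne')
  · have hn : (n : WithTop ℕ∞) ≤ ∞ := by exact_mod_cast le_top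
    have hscale : ρ * μ ^ t * μ ^ (-t) = ρ := by
      rw [mul_assoc, ← Real.rpow_add hμ, add_neg_cancel, Real.rpow_zero, mul_one]
    refine (jetNorm_mul_le (by positivity) contDiffAt_const (hcd'.of_le hn)).trans ?_
    rw [jetNorm_const, Complex.norm_real, Real.norm_of_nonneg (by positivity),
      jetNorm_comp_add_mul n (ρ * μ ^ t) (fun v => (Complex.I * deriv θ v - Complex.I * ξ)⁻¹) x
        (by positivity) y, hscale, mul_comm]
    gcongr
    exact hjet n

end Homogeneous

theorem exists_mem_nhds_forall_abs_le {P : ℝ × ℝ → Prop} {z : ℝ × ℝ} (h : ∀ᶠ p in 𝓝 z, P p) :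
    ∃ V ∈ 𝓝 z, ∃ ε : ℝ, 0 < ε ∧ ∀ p ∈ V, ∀ w, |w| ≤ ε → P (p.1 + w, p.2) := by
  have hshift : Tendsto (fun q : (ℝ × ℝ) × ℝ => (q.1.1 + q.2, q.1.2)) (𝓝 z ×ˢ 𝓝 0) (𝓝 z) := by
    rw [← nhds_prod_eq]
    exact Continuous.tendsto' (by fun_prop) _ _ (by simp)
  obtain ⟨V, hV, W, hW, hVW⟩ := eventually_prod_iff.1 (hshift.eventually h)
  obtain ⟨ε, hε, hεW⟩ := Metric.nhds_basis_closedBall.eventually_iff.1 hW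
  exact ⟨{p | V p}, hV, ε, hε, fun p hp w hw => hVW hp (hεW (mem_closedBall_zero_iff.2 hw))⟩

theorem decaysNear_of_deriv_ne {t s : ℝ} (ht : 0 < t) (hs : 1 ≤ s) (ψ : Space t s)
    {θ : ℝ → ℝ} (hθ : Continuous θ)
    (hhom : ∀ μ : ℝ, 0 < μ → ∀ v, θ (μ ^ t * v) = μ ^ (s + t) * θ v) {x₀ ξ₀ : ℝ}
    (han : AnalyticAt ℝ θ x₀) (hne : deriv θ x₀ ≠ ξ₀) (hz : (x₀, ξ₀) ≠ (0 : ℝ × ℝ)) :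
    DecaysNear ht (zero_lt_one.trans_le hs) ψ (ofFunction t s (oscillation θ hθ)) (x₀, ξ₀) := by
  have hanI : AnalyticAt ℝ (fun v => Complex.I * ((deriv θ v : ℝ) : ℂ)) x₀ :=
    analyticAt_const.mul ((Complex.ofRealCLM.analyticAt _).comp han.deriv)
  obtain ⟨ρ, hρ, Q, hQ, hjet⟩ := exists_eventually_jetNorm_inv_sub_le hanI
    (ζ₀ := Complex.I * ξ₀) (by simpa using hne)
  have hlocal : ∀ᶠ p : ℝ × ℝ in 𝓝 (x₀, ξ₀), AnalyticAt ℝ θ p.1 ∧ deriv θ p.1 ≠ p.2 ∧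
      ∀ n, jetNorm n ρ (fun v => (Complex.I * deriv θ v - Complex.I * p.2)⁻¹) p.1 ≤ Q := by
    have hI : Tendsto (fun p : ℝ × ℝ => (p.1, Complex.I * (p.2 : ℂ))) (𝓝 (x₀, ξ₀))
        (𝓝 (x₀, Complex.I * (ξ₀ : ℂ))) := Continuous.tendsto (by fun_prop) (x₀, ξ₀)
    have hderiv : ContinuousAt (fun p : ℝ × ℝ => deriv θ p.1) (x₀, ξ₀) :=
      ContinuousAt.comp (g := deriv θ) han.deriv.continuousAt continuousAt_fst
    exact ((continuous_fst.tendsto (x₀, ξ₀)).eventually han.eventually_analyticAt).and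
      (((hderiv.ne_iff_eventually_ne continuousAt_snd).1 hne).and (hI.eventually hjet))
  obtain ⟨V, hV, ε, hε, hVε⟩ := exists_mem_nhds_forall_abs_le hlocal
  refine decaysNear_oscillation ht (zero_lt_one.trans_le hs) ψ hθ hz hV fun r hr => ?_
  obtain ⟨C, hC⟩ := exists_norm_integral_le ht hs ψ hρ hQ hε hr
  refine ⟨stftConst * C, ?_⟩
  filter_upwards [hC, eventually_gt_atTop 0] with μ hCμ hμ p hp
  rw [norm_stft_oscillation_eq_shift, mul_assoc]
  refine mul_le_mul_of_nonneg_left ?_ stftConst_pos.le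
  refine hCμ _
    (fun y => (μ ^ (-s) : ℝ) * (Complex.I * deriv θ (p.1 + μ ^ (-t) * y) - Complex.I * p.2)⁻¹)
    (by fun_prop) (fun y => (Complex.norm_exp_I_mul_ofReal _).le) fun y hy => ?_
  obtain ⟨hp1, hp2, hp3⟩ := hVε p hp (μ ^ (-t) * y) <| by
    rwa [abs_mul, abs_of_pos (by positivity), Real.rpow_neg hμ.le, inv_mul_le_iff₀ (by positivity)]
  exact isNonstationaryAt_exp hhom hρ.le hμ hp1 hp2 hp3

theorem decaysNear_monomialChirp {c : ℝ} {m : ℕ} {t : ℝ} (ht : 0 < t)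
    (hs : 1 ≤ t * ((m : ℝ) - 1)) (ψ : Space t (t * ((m : ℝ) - 1)))
    {x₀ ξ₀ : ℝ} (hne : c * m * x₀ ^ (m - 1) ≠ ξ₀) (hz : (x₀, ξ₀) ≠ (0 : ℝ × ℝ)) :
    DecaysNear ht (zero_lt_one.trans_le hs) ψ (ofFunction t _ (monomialChirp c m)) (x₀, ξ₀) := by
  refine decaysNear_of_deriv_ne ht hs ψ _ (fun μ hμ v => ?_) (by fun_prop) ?_ hz
  · rw [show t * ((m : ℝ) - 1) + t = t * m by ring, Real.rpow_mul hμ.le, Real.rpow_natCast]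
    ring
  · simpa [mul_assoc] using hne

theorem analyticAt_abs_rpow {x : ℝ} (hx : x ≠ 0) (p : ℝ) :
    AnalyticAt ℝ (fun v : ℝ => |v| ^ p) x := by
  have hexp : (fun v : ℝ => Real.exp (Real.log v * p)) =ᶠ[𝓝 x] fun v => |v| ^ p := by
    filter_upwards [eventually_ne_nhds hx] with v hv
    rw [Real.rpow_def_of_pos (abs_pos.2 hv), Real.log_abs]
  exact ((Real.contDiffAt_log.2 hx).analyticAt.mul analyticAt_const).rexp'.congr hexp

theorem deriv_const_mul_abs_rpow (c : ℝ) {α : ℝ} (hα : 1 < α) (x : ℝ) :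
    deriv (fun x => c * |x| ^ α) x = c * α * Real.sign x * |x| ^ (α - 1) := by
  have hsign : |x| ^ (α - 2) * x = Real.sign x * |x| ^ (α - 1) := by
    rcases eq_or_ne x 0 with rfl | hx
    · simp
    · have hx' : |x| * Real.sign x = x := by
        rcases hx.lt_or_gt with h | h
        · simp [abs_of_neg h, Real.sign_of_neg h]
        · simp [abs_of_pos h, Real.sign_of_pos h]
      nth_rw 2 [← hx']
      rw [show α - 1 = α - 2 + 1 by ring, Real.rpow_add_one (abs_ne_zero.2 hx)]
      ring
  rw [((hasDerivAt_abs_rpow x hα).const_mul c).deriv, mul_assoc α, hsign]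
  ring

theorem decaysNear_powerChirp {c α t : ℝ} (hα : 1 < α) (ht : 0 < t) (hs : 1 ≤ t * (α - 1))
    (ψ : Space t (t * (α - 1))) {x₀ ξ₀ : ℝ} (hx₀ : x₀ ≠ 0)
    (hne : c * α * Real.sign x₀ * |x₀| ^ (α - 1) ≠ ξ₀) :
    DecaysNear ht (zero_lt_one.trans_le hs) ψ
      (ofFunction t _ (powerChirp c α (zero_le_one.trans hα.le))) (x₀, ξ₀) := by
  refine decaysNear_of_deriv_ne ht hs ψ _ (fun μ hμ v => ?_) ?_ ?_ (by simp [hx₀])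
  · rw [show t * (α - 1) + t = t * α by ring, abs_mul, abs_of_pos (by positivity),
      Real.mul_rpow (by positivity) (abs_nonneg v), Real.rpow_mul hμ.le]
    ring
  · exact analyticAt_const.mul (analyticAt_abs_rpow hx₀ α)
  · rwa [deriv_const_mul_abs_rpow c hα]

/-! ### Anisotropic dilations -/

/-- The dilation `(x, ξ) ↦ (μ ^ t x, μ ^ s ξ)` whose orbits replace rays in the definition of the
wave front set. -/
def dilation (t s μ : ℝ) (p : ℝ × ℝ) : ℝ × ℝ := (μ ^ t * p.1, μ ^ s * p.2)

/-- A gauge on the plane that is homogeneous of degree one under `dilation t s`. -/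
def gauge (t s : ℝ) (p : ℝ × ℝ) : ℝ := |p.1| ^ t⁻¹ + |p.2| ^ s⁻¹

section Dilation

variable {t s : ℝ}

theorem continuous_dilation (t s μ : ℝ) : Continuous (dilation t s μ) := by
  unfold dilation
  fun_prop

theorem dilation_dilation {μ κ : ℝ} (hμ : 0 ≤ μ) (hκ : 0 ≤ κ) (p : ℝ × ℝ) :
    dilation t s μ (dilation t s κ p) = dilation t s (μ * κ) p := by
  simp only [dilation, Real.mul_rpow hμ hκ, mul_assoc]

theorem dilation_inv_dilation {κ : ℝ} (hκ : 0 < κ) (p : ℝ × ℝ) :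
    dilation t s κ⁻¹ (dilation t s κ p) = p := by
  rw [dilation_dilation (inv_nonneg.2 hκ.le) hκ.le, inv_mul_cancel₀ hκ.ne']
  simp [dilation]

theorem gauge_dilation (ht : t ≠ 0) (hs : s ≠ 0) {μ : ℝ} (hμ : 0 ≤ μ) (p : ℝ × ℝ) :
    gauge t s (dilation t s μ p) = μ * gauge t s p := by
  have hscale {q : ℝ} (hq : q ≠ 0) (v : ℝ) : |μ ^ q * v| ^ q⁻¹ = μ * |v| ^ q⁻¹ := by
    rw [abs_mul, abs_of_nonneg (by positivity), Real.mul_rpow (by positivity) (abs_nonneg v),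
      Real.rpow_rpow_inv hμ hq]
  rw [gauge, gauge, dilation, hscale ht, hscale hs, mul_add]

theorem gauge_pos {p : ℝ × ℝ} (hp : p ≠ 0) : 0 < gauge t s p := by
  rcases not_and_or.1 (mt Prod.ext_iff.2 hp) with h | h <;> replace h := abs_pos.2 h
  · exact add_pos_of_pos_of_nonneg (by positivity) (by positivity)
  · exact add_pos_of_nonneg_of_pos (by positivity) (by positivity)

theorem isCompact_gauge_eq_one (ht : 0 < t) (hs : 0 < s) :
    IsCompact {p : ℝ × ℝ | gauge t s p = 1} := by
  have hcont : Continuous (gauge t s) :=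
    (continuous_fst.abs.rpow_const fun _ => .inr (inv_nonneg.2 ht.le)).add
      (continuous_snd.abs.rpow_const fun _ => .inr (inv_nonneg.2 hs.le))
  refine (isCompact_closedBall (0 : ℝ × ℝ) 1).of_isClosed_subset
    (isClosed_eq hcont continuous_const) fun p hp => ?_
  have hle {q v : ℝ} (hq : 0 < q) (h : |v| ^ q⁻¹ ≤ 1) : |v| ≤ 1 := by
    rwa [Real.rpow_inv_le_iff_of_pos (abs_nonneg v) zero_le_one hq, Real.one_rpow] at h
  have hsum : |p.1| ^ t⁻¹ + |p.2| ^ s⁻¹ = 1 := hp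
  rw [mem_closedBall_zero_iff, Prod.norm_def]
  exact max_le (hle ht (by linarith [show 0 ≤ |p.2| ^ s⁻¹ by positivity]))
    (hle hs (by linarith [show 0 ≤ |p.1| ^ t⁻¹ by positivity]))

variable {ht : 0 < t} {hs : 0 < s} {ψ : Space t s} {u : Ultradistribution t s}

theorem decaysNear_dilation {z : ℝ × ℝ} (h : DecaysNear ht hs ψ u z) {κ : ℝ} (hκ : 0 < κ) :
    DecaysNear ht hs ψ u (dilation t s κ z) := by
  obtain ⟨U, hU, hU0, hzU, hdecay⟩ := h
  refine ⟨dilation t s κ⁻¹ ⁻¹' U, hU.preimage (continuous_dilation t s κ⁻¹),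
    by simpa [dilation, Prod.mk_zero_zero] using hU0,
    by rwa [Set.mem_preimage, dilation_inv_dilation hκ],
    fun r hr => ?_⟩
  obtain ⟨C, hC⟩ := hdecay (r / κ) (by positivity)
  refine ⟨C, fun μ hμ p hp => ?_⟩
  have hscale (q v : ℝ) : (μ * κ) ^ q * (κ⁻¹ ^ q * v) = μ ^ q * v := by
    rw [← mul_assoc, ← Real.mul_rpow (by positivity) (by positivity),
      mul_inv_cancel_right₀ hκ.ne']
  have hbound := hC (μ * κ) (by positivity) _ hp
  rwa [dilation, hscale, hscale, div_mul_eq_mul_div, mul_div_assoc,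
    mul_div_cancel_right₀ μ hκ.ne'] at hbound

theorem exists_norm_stft_dilation_le {K : Set (ℝ × ℝ)} (hK : IsCompact K)
    (h : ∀ z ∈ K, DecaysNear ht hs ψ u z) {r : ℝ} (hr : 0 < r) :
    ∃ C : ℝ, ∀ p ∈ K, ∀ μ : ℝ, 0 < μ →
      Real.exp (r * μ) * ‖stft ht hs ψ u (μ ^ t * p.1) (μ ^ s * p.2)‖ ≤ C := by
  refine hK.induction_on (p := fun S => ∃ C : ℝ, ∀ p ∈ S, ∀ μ : ℝ, 0 < μ →
    Real.exp (r * μ) * ‖stft ht hs ψ u (μ ^ t * p.1) (μ ^ s * p.2)‖ ≤ C)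
    ⟨0, fun p hp => hp.elim⟩ (fun S T hST ⟨C, hC⟩ => ⟨C, fun p hp => hC p (hST hp)⟩) ?_ ?_
  · rintro S T ⟨C, hC⟩ ⟨D, hD⟩
    refine ⟨max C D, fun p hp μ hμ => ?_⟩
    rcases hp with hp | hp
    · exact le_max_of_le_left (hC p hp μ hμ)
    · exact le_max_of_le_right (hD p hp μ hμ)
  · intro z hz
    obtain ⟨U, hU, -, hzU, hdecay⟩ := h z hz
    obtain ⟨C, hC⟩ := hdecay r hr
    exact ⟨U, mem_nhdsWithin_of_mem_nhds (hU.mem_nhds hzU), C, fun p hp μ hμ => hC μ hμ p hp⟩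

theorem exists_norm_stft_le_exp_neg_gauge {S : Set (ℝ × ℝ)} (hS : IsClosed S)
    (hSdil : ∀ z ∈ S, ∀ κ : ℝ, 0 < κ → dilation t s κ z ∈ S)
    (h : ∀ z ∈ S, z ≠ 0 → DecaysNear ht hs ψ u z) :
    ∃ C : ℝ, ∀ z ∈ S, z ≠ 0 → ‖stft ht hs ψ u z.1 z.2‖ ≤ C * Real.exp (-gauge t s z) := by
  have hne {z : ℝ × ℝ} (hz : gauge t s z = 1) : z ≠ 0 := by
    rintro rfl
    simp [gauge, ht.ne', hs.ne'] at hz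
  obtain ⟨C, hC⟩ := exists_norm_stft_dilation_le (u := u) (ψ := ψ)
    ((isCompact_gauge_eq_one ht hs).inter_left hS) (fun z hz => h z hz.1 (hne hz.2)) one_pos
  refine ⟨C, fun z hz hz0 => ?_⟩
  have hpos : 0 < gauge t s z := gauge_pos hz0
  have hunit : gauge t s (dilation t s (gauge t s z)⁻¹ z) = 1 := by
    rw [gauge_dilation ht.ne' hs.ne' (by positivity), inv_mul_cancel₀ hpos.ne']
  have hback := dilation_inv_dilation (t := t) (s := s) (inv_pos.2 hpos) z
  rw [inv_inv] at hback
  have hbound : Real.exp (1 * gauge t s z) * ‖stft ht hs ψ u (dilation t s (gauge t s z) _).1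
    (dilation t s (gauge t s z) _).2‖ ≤ C := hC _ ⟨hSdil z hz _ (inv_pos.2 hpos), hunit⟩ _ hpos
  rwa [hback, one_mul, ← le_div_iff₀' (Real.exp_pos _), div_eq_mul_inv, ← Real.exp_neg] at hbound

end Dilation

/-! ### Singularities of the monomial chirp -/

section Inversion

variable {t s : ℝ} {θ : ℝ → ℝ}

theorem norm_windowedOscillation (θ : ℝ → ℝ) (ψ : Space t s) (x y : ℝ) :
    ‖windowedOscillation θ ψ x y‖ = ‖(ψ : ℝ → ℂ) (y - x)‖ := by
  rw [windowedOscillation, norm_mul, Complex.norm_exp_I_mul_ofReal, one_mul, RCLike.norm_conj]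

theorem continuous_windowedOscillation (hθ : Continuous θ) (ψ : Space t s) (x : ℝ) :
    Continuous (windowedOscillation θ ψ x) := by
  have hψ := contDiff_conj_coe ψ |>.continuous
  unfold windowedOscillation
  exact Continuous.mul (by fun_prop) (hψ.comp (by fun_prop))

theorem integrable_windowedOscillation (hθ : Continuous θ) (ψ : Space t s) (x : ℝ) :
    Integrable (windowedOscillation θ ψ x) :=
  ((integrable_coe ψ).comp_sub_right x).norm.mono'
    (continuous_windowedOscillation hθ ψ x).aestronglyMeasurable
    (.of_forall fun y => (norm_windowedOscillation θ ψ x y).le)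

theorem fourier_eq_angularFourier (f : ℝ → ℂ) (v : ℝ) :
    FourierTransform.fourier f v = angularFourier f (2 * Real.pi * v) := by
  rw [Real.fourier_real_eq_integral_exp_smul, angularFourier]
  congr 1 with y
  rw [smul_eq_mul]
  congr 2
  push_cast
  ring

theorem continuous_angularFourier {f : ℝ → ℂ} (hf : Integrable f) :
    Continuous (angularFourier f) := by
  refine continuous_of_dominated (bound := fun y => ‖f y‖)
    (fun ξ => (Continuous.aestronglyMeasurable (by fun_prop)).mul hf.aestronglyMeasurable)
    (fun ξ => .of_forall fun y => ?_) hf.norm (.of_forall fun y => by fun_prop)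
  rw [← mul_neg, ← Complex.ofReal_neg, norm_mul, Complex.norm_exp_I_mul_ofReal, one_mul]

theorem norm_mul_two_pi_le_integral {f : ℝ → ℂ} (hf : Continuous f) (hfi : Integrable f)
    {B : ℝ → ℝ} (hB : Integrable B) (h : ∀ ξ, ‖angularFourier f ξ‖ ≤ B ξ) (y : ℝ) :
    ‖f y‖ * (2 * Real.pi) ≤ ∫ ξ, B ξ := by
  have hBv : Integrable fun v => B (2 * Real.pi * v) := hB.comp_mul_left' (by positivity)
  have hle (v : ℝ) : ‖FourierTransform.fourier f v‖ ≤ B (2 * Real.pi * v) :=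
    (congrArg norm (fourier_eq_angularFourier f v)).trans_le (h _)
  have hcont : Continuous (FourierTransform.fourier f) := by
    simp_rw [funext (fourier_eq_angularFourier f)]
    exact (continuous_angularFourier hfi).comp (by fun_prop)
  have hint : Integrable (FourierTransform.fourier f) :=
    hBv.mono' hcont.aestronglyMeasurable (.of_forall hle)
  have hnorm : ‖f y‖ ≤ ∫ v, B (2 * Real.pi * v) := by
    rw [← congrFun (hf.fourierInv_fourier_eq hfi hint) y, Real.fourierInv_eq']
    refine norm_integral_le_of_norm_le hBv (.of_forall fun v => ?_)
    rw [norm_smul, Complex.norm_exp_ofReal_mul_I, one_mul]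
    exact hle v
  rwa [Measure.integral_comp_mul_left, smul_eq_mul, abs_of_pos (by positivity),
    ← div_eq_inv_mul, le_div_iff₀ (by positivity)] at hnorm

theorem norm_coe_le_integral_of_norm_stft_le (ht : 0 < t) (hs : 0 < s) (ψ : Space t s)
    (hθ : Continuous θ) {x : ℝ} {B : ℝ → ℝ} (hB : Integrable B)
    (h : ∀ ξ, ‖stft ht hs ψ (ofFunction t s (oscillation θ hθ)) x ξ‖ ≤ B ξ) (y : ℝ) :
    stftConst * (‖(ψ : ℝ → ℂ) y‖ * (2 * Real.pi)) ≤ ∫ ξ, B ξ := by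
  have hle (ξ : ℝ) : ‖angularFourier (windowedOscillation θ ψ x) ξ‖ ≤ stftConst⁻¹ * B ξ := by
    rw [← div_eq_inv_mul, le_div_iff₀' stftConst_pos, ← norm_stft_oscillation ht hs ψ hθ]
    exact h ξ
  have hinv := norm_mul_two_pi_le_integral (continuous_windowedOscillation hθ ψ x)
    (integrable_windowedOscillation hθ ψ x) (hB.const_mul _) hle (y + x)
  rwa [norm_windowedOscillation, add_sub_cancel_right, integral_const_mul, ← div_eq_inv_mul,
    le_div_iff₀' stftConst_pos] at hinv

end Inversion

theorem eq_zero_of_decaysNear_halfPlane {t s : ℝ} {ht : 0 < t} {hs : 0 < s} {ψ : Space t s}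
    {θ : ℝ → ℝ} {hθ : Continuous θ} {a : ℝ} (ha : a ≠ 0)
    (h : ∀ z : ℝ × ℝ, 0 ≤ a * z.1 → z ≠ 0 →
      DecaysNear ht hs ψ (ofFunction t s (oscillation θ hθ)) z) : ψ = 0 := by
  have hdil (z : ℝ × ℝ) (hz : 0 ≤ a * z.1) (κ : ℝ) (hκ : 0 < κ) :
      0 ≤ a * (dilation t s κ z).1 := by
    rw [dilation, mul_left_comm]
    positivity
  obtain ⟨C, hC⟩ := exists_norm_stft_le_exp_neg_gauge (S := {z | 0 ≤ a * z.1})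
    (isClosed_le continuous_const (by fun_prop)) hdil h
  ext y
  set D := ∫ ξ : ℝ, C * Real.exp (-(1 * |ξ| ^ s⁻¹))
  have hbound : ∀ k : ℝ, 0 < k →
      stftConst * (‖(ψ : ℝ → ℂ) y‖ * (2 * Real.pi)) ≤ Real.exp (-|k * a| ^ t⁻¹) * D := by
    intro k hk
    rw [← integral_const_mul]
    refine norm_coe_le_integral_of_norm_stft_le ht hs ψ hθ (x := k * a)
      (((integrable_exp_neg_mul_abs_rpow (inv_pos.2 hs) one_pos).const_mul C).const_mul _)
      (fun ξ => (hC (k * a, ξ) ?_ ?_).trans_eq ?_) y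
    · rw [Set.mem_ofPred_eq, mul_left_comm]
      exact mul_nonneg hk.le (mul_self_nonneg a)
    · simp [hk.ne', ha]
    · rw [gauge, neg_add, Real.exp_add, one_mul]
      ring
  have hlim : Tendsto (fun k : ℝ => Real.exp (-|k * a| ^ t⁻¹) * D) atTop (𝓝 0) := by
    have habs : Tendsto (fun k : ℝ => |k * a| ^ t⁻¹) atTop atTop := by
      refine (tendsto_rpow_atTop (inv_pos.2 ht)).comp ?_
      simp_rw [abs_mul]
      exact tendsto_abs_atTop_atTop.atTop_mul_const (abs_pos.2 ha)
    simpa using (Real.tendsto_exp_neg_atTop_nhds_zero.comp habs).mul_const D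
  have hzero := ge_of_tendsto hlim ((eventually_gt_atTop 0).mono hbound)
  have hpos : 0 < stftConst * (2 * Real.pi) := mul_pos stftConst_pos (by positivity)
  refine norm_le_zero_iff.1 (nonpos_of_mul_nonpos_right ?_ hpos)
  linarith

theorem exists_dilation_eq_of_sameSide {c t : ℝ} {m : ℕ} (hm : 1 ≤ m) (ht : t ≠ 0) {x x' : ℝ}
    (h : 0 < x * x') :
    ∃ κ : ℝ, 0 < κ ∧ dilation t (t * ((m : ℝ) - 1)) κ (x, c * m * x ^ (m - 1)) =
      (x', c * m * x' ^ (m - 1)) := by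
  have hx : x ≠ 0 := left_ne_zero_of_mul h.ne'
  have hquot : 0 < x' / x := by
    rw [← mul_div_mul_left x' x hx]
    exact div_pos h (mul_self_pos.2 hx)
  refine ⟨(x' / x) ^ t⁻¹, by positivity, ?_⟩
  rw [dilation, Real.rpow_mul (by positivity), Real.rpow_inv_rpow hquot.le ht,
    ← Nat.cast_pred hm, Real.rpow_natCast, div_pow]
  ext <;> field_simp

theorem waveFrontSet_monomialChirp {c : ℝ} {m : ℕ} (hm : 2 ≤ m) {t : ℝ} (ht : 0 < t)
    (hs : 1 ≤ t * ((m : ℝ) - 1)) {ψ : Space t (t * ((m : ℝ) - 1))} (hψ : ψ ≠ 0) :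
    waveFrontSet ht (zero_lt_one.trans_le hs) ψ (ofFunction t _ (monomialChirp c m)) =
      {p : ℝ × ℝ | ∃ x : ℝ, x ≠ 0 ∧ p = (x, c * m * x ^ (m - 1))} := by
  have hm0 : m - 1 ≠ 0 := by omega
  ext ⟨x, ξ⟩
  rw [mem_waveFrontSet_iff]
  constructor
  · rintro ⟨hz, hdec⟩
    have hξ : c * m * x ^ (m - 1) = ξ :=
      of_not_not fun hne => hdec (decaysNear_monomialChirp ht hs ψ hne hz)
    refine ⟨x, fun hx => hz ?_, by rw [hξ]⟩
    rw [← hξ, hx, zero_pow hm0, mul_zero, Prod.mk_zero_zero]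
  · rintro ⟨x', hx', h⟩
    obtain ⟨rfl, rfl⟩ := Prod.mk.inj h
    refine ⟨fun h0 => hx' (congrArg Prod.fst h0), fun hdec =>
      hψ (eq_zero_of_decaysNear_halfPlane (ht := ht) (hs := zero_lt_one.trans_le hs)
        (θ := fun x => c * x ^ m) (hθ := by fun_prop) hx' ?_)⟩
    rintro ⟨v, η⟩ hv hz
    by_cases hcurve : c * m * v ^ (m - 1) = η
    · subst hcurve
      have hv0 : v ≠ 0 := by
        rintro rfl
        simp [hm0] at hz
      obtain ⟨κ, hκ, h⟩ := exists_dilation_eq_of_sameSide (c := c) (m := m) (by omega) ht.ne'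
        (hv.lt_of_ne' (mul_ne_zero hx' hv0))
      exact h ▸ decaysNear_dilation hdec hκ
    · exact decaysNear_monomialChirp ht hs ψ hcurve hz

/-! ### The power function against the kernels `(1 + iy) ^ (-n - 1)` -/

theorem integrableOn_rpow_mul_exp_neg_mul {α r : ℝ} (hα : -1 < α) (hr : 0 < r) :
    IntegrableOn (fun y : ℝ => y ^ α * Real.exp (-(r * y))) (Set.Ioi 0) := by
  simpa using integrableOn_rpow_mul_exp_neg_mul_rpow (p := 1) hα one_pos hr

theorem differentiableAt_integral_rpow_mul_cexp {α : ℝ} (hα : -1 < α) {z : ℂ} (hz : 0 < z.re) :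
    DifferentiableAt ℂ
      (fun z : ℂ => ∫ y : ℝ in Set.Ioi 0, ((y ^ α : ℝ) : ℂ) * Complex.exp (-(z * y))) z := by
  set μ : Measure ℝ := (volume.restrict (Set.Ioi 0)).withDensity fun y => (y ^ α).toNNReal
  have hmeas : Measurable fun y : ℝ => (y ^ α).toNNReal := by fun_prop
  have hpos : ∀ᵐ y : ℝ ∂volume.restrict (Set.Ioi 0), 0 < y := ae_restrict_mem measurableSet_Ioi
  have hmgf : ProbabilityTheory.complexMGF (fun y => -y) μ =
      fun z => ∫ y : ℝ in Set.Ioi 0, ((y ^ α : ℝ) : ℂ) * Complex.exp (-(z * y)) := by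
    funext z
    rw [ProbabilityTheory.complexMGF, integral_withDensity_eq_integral_smul hmeas]
    refine integral_congr_ae (hpos.mono fun y hy => ?_)
    simp only [NNReal.smul_def, Real.coe_toNNReal _ (Real.rpow_nonneg hy.le α),
      Complex.real_smul, Complex.ofReal_neg, mul_neg]
  have hexp {r : ℝ} (hr : 0 < r) : r ∈ ProbabilityTheory.integrableExpSet (fun y => -y) μ := by
    refine (integrable_withDensity_iff_integrable_smul hmeas).2 ?_
    refine (integrableOn_rpow_mul_exp_neg_mul hα hr).congr (hpos.mono fun y hy => ?_)
    simp only [NNReal.smul_def, Real.coe_toNNReal _ (Real.rpow_nonneg hy.le α), smul_eq_mul,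
      mul_neg]
  rw [← hmgf]
  exact (ProbabilityTheory.hasDerivAt_complexMGF <|
    mem_interior_iff_mem_nhds.2 ((eventually_gt_nhds hz).mono fun r => hexp)).differentiableAt

theorem integral_rpow_mul_cexp_neg_mul {α : ℝ} (hα : -1 < α) {z : ℂ} (hz : 0 < z.re) :
    ∫ y : ℝ in Set.Ioi 0, ((y ^ α : ℝ) : ℂ) * Complex.exp (-(z * y)) =
      (1 / z) ^ (α + 1 : ℂ) * Real.Gamma (α + 1) := by
  have hopen : IsOpen {z : ℂ | 0 < z.re} := isOpen_lt continuous_const Complex.continuous_re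
  have hpow : AnalyticOnNhd ℂ (fun z : ℂ => (1 / z) ^ (α + 1 : ℂ) * Real.Gamma (α + 1))
      {z : ℂ | 0 < z.re} := by
    intro z hz
    have hz0 : z ≠ 0 := fun h => hz.ne' (congrArg Complex.re h)
    refine ((analyticAt_const.div analyticAt_id hz0).cpow analyticAt_const
      (.inl ?_)).mul analyticAt_const
    simpa [Complex.normSq_pos.2 hz0] using div_pos hz (Complex.normSq_pos.2 hz0)
  have hreal : ∀ᶠ r : ℝ in 𝓝[≠] 1,
      ∫ y : ℝ in Set.Ioi 0, ((y ^ α : ℝ) : ℂ) * Complex.exp (-((r : ℂ) * y)) =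
        (1 / (r : ℂ)) ^ (α + 1 : ℂ) * Real.Gamma (α + 1) := by
    filter_upwards [nhdsWithin_le_nhds (eventually_gt_nhds (zero_lt_one' ℝ))] with r hr
    have hint := Real.integral_rpow_mul_exp_neg_mul_Ioi (a := α + 1) (by linarith) hr
    rw [add_sub_cancel_right] at hint
    have hcast (y : ℝ) : ((y ^ α : ℝ) : ℂ) * Complex.exp (-((r : ℂ) * y)) =
        ((y ^ α * Real.exp (-(r * y)) : ℝ) : ℂ) := by push_cast; rfl
    simp_rw [hcast]
    rw [integral_complex_ofReal, hint, Complex.ofReal_mul, Complex.ofReal_cpow (by positivity)]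
    push_cast
    rfl
  have hne : Tendsto Complex.ofReal (𝓝[≠] 1) (𝓝[≠] 1) :=
    tendsto_nhdsWithin_of_tendsto_nhds_of_eventually_within _
      (Complex.continuous_ofReal.tendsto' 1 1 Complex.ofReal_one |>.mono_left nhdsWithin_le_nhds)
      (eventually_mem_nhdsWithin.mono fun r hr => by simpa using hr)
  exact AnalyticOnNhd.eqOn_of_preconnected_of_frequently_eq
    (DifferentiableOn.analyticOnNhd (fun z hz =>
      (differentiableAt_integral_rpow_mul_cexp hα hz).differentiableWithinAt) hopen)
    hpow (convex_halfSpace_re_gt 0).isPreconnected (zero_lt_one' ℝ)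
    (hne.frequently hreal.frequently) hz

theorem integral_pow_mul_exp_neg_mul (n : ℕ) {z : ℂ} (hz : 0 < z.re) :
    ∫ ξ : ℝ in Set.Ioi 0, (ξ : ℂ) ^ n * Complex.exp (-(z * ξ)) = n ! * (z ^ (n + 1))⁻¹ := by
  have hint := integral_rpow_mul_cexp_neg_mul (α := n) (by linarith [n.cast_nonneg (α := ℝ)]) hz
  simp only [Real.rpow_natCast, Complex.ofReal_pow, Complex.ofReal_natCast] at hint
  rw [hint, Real.Gamma_nat_eq_factorial, Complex.ofReal_natCast, ← Nat.cast_succ,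
    Complex.cpow_natCast, one_div, inv_pow, mul_comm]

theorem ofReal_mul_cpow {r : ℝ} (hr : 0 < r) {z : ℂ} (hz : z ≠ 0) (w : ℂ) :
    (r * z) ^ w = (r : ℂ) ^ w * z ^ w := by
  have hr' : (r : ℂ) ≠ 0 := by exact_mod_cast hr.ne'
  rw [Complex.cpow_def_of_ne_zero (mul_ne_zero hr' hz), Complex.cpow_def_of_ne_zero hr',
    Complex.cpow_def_of_ne_zero hz, Complex.log_ofReal_mul hr hz, Complex.ofReal_log hr.le,
    add_mul, Complex.exp_add]

theorem integrable_rpow_mul_pow_mul_cexp {α : ℝ} {n : ℕ} (hα : -1 < α) (hn : α < n) {z : ℂ}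
    (hz : 0 < z.re) :
    Integrable (fun p : ℝ × ℝ => ((p.1 ^ α : ℝ) : ℂ) *
      ((p.2 : ℂ) ^ n * Complex.exp (-((1 + z * p.1) * p.2))))
      ((volume.restrict (Set.Ioi 0)).prod (volume.restrict (Set.Ioi 0))) := by
  have hnorm {y ξ : ℝ} (hy : 0 < y) (hξ : 0 < ξ) : ‖((y ^ α : ℝ) : ℂ) *
      ((ξ : ℂ) ^ n * Complex.exp (-((1 + z * y) * ξ)))‖ =
        ξ ^ n * Real.exp (-ξ) * (y ^ α * Real.exp (-(z.re * ξ * y))) := by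
    have hre : (-((1 + z * y) * ξ)).re = -ξ + -(z.re * ξ * y) := by
      simp
      ring
    rw [norm_mul, norm_mul, norm_pow, Complex.norm_exp, Complex.norm_real, Complex.norm_real,
      Real.norm_of_nonneg (by positivity), Real.norm_of_nonneg hξ.le, hre, Real.exp_add]
    ring
  have hmeas : AEStronglyMeasurable (fun p : ℝ × ℝ => ((p.1 ^ α : ℝ) : ℂ) *
      ((p.2 : ℂ) ^ n * Complex.exp (-((1 + z * p.1) * p.2))))
      ((volume.restrict (Set.Ioi 0)).prod (volume.restrict (Set.Ioi 0))) :=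
    (Measurable.aestronglyMeasurable (by fun_prop)).mul
      (Continuous.aestronglyMeasurable (by fun_prop))
  have hpos : ∀ᵐ ξ : ℝ ∂volume.restrict (Set.Ioi 0), 0 < ξ := ae_restrict_mem measurableSet_Ioi
  refine (integrable_prod_iff' hmeas).2 ⟨?_, ?_⟩
  · filter_upwards [hpos] with ξ hξ
    refine ((integrableOn_rpow_mul_exp_neg_mul hα (mul_pos hz hξ)).const_mul _).mono'
      ((Measurable.aestronglyMeasurable (by fun_prop)).mul
        (Continuous.aestronglyMeasurable (by fun_prop))) (hpos.mono fun y hy => (hnorm hy hξ).le)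
  · have hint : IntegrableOn (fun ξ : ℝ => ξ ^ (n - α - 1) * Real.exp (-(1 * ξ)) *
        (z.re⁻¹ ^ (α + 1) * Real.Gamma (α + 1))) (Set.Ioi 0) :=
      (integrableOn_rpow_mul_exp_neg_mul (by linarith) one_pos).mul_const _
    refine hint.congr (hpos.mono fun ξ hξ => ?_)
    have hint := Real.integral_rpow_mul_exp_neg_mul_Ioi (a := α + 1) (by linarith) (mul_pos hz hξ)
    rw [add_sub_cancel_right] at hint
    simp only
    rw [integral_congr_ae (hpos.mono fun y hy => hnorm hy hξ), integral_const_mul, hint, one_div,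
      mul_inv, Real.mul_rpow (by positivity) (by positivity), Real.inv_rpow hξ.le, one_mul,
      show (n : ℝ) - α - 1 = n - (α + 1) by ring, Real.rpow_sub hξ, Real.rpow_natCast]
    ring

theorem integral_rpow_mul_pow_mul_cexp {α : ℝ} (n : ℕ) (hα : -1 < α) {z : ℂ} (hz : 0 < z.re)
    {ξ : ℝ} (hξ : 0 < ξ) :
    ∫ y : ℝ in Set.Ioi 0, ((y ^ α : ℝ) : ℂ) *
      ((ξ : ℂ) ^ n * Complex.exp (-((1 + z * y) * ξ))) =
    (1 / z) ^ (α + 1 : ℂ) * Real.Gamma (α + 1) *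
      ((ξ ^ ((n : ℝ) - α - 1) * Real.exp (-(1 * ξ)) : ℝ) : ℂ) := by
  have hz0 : z ≠ 0 := fun h => hz.ne' (congrArg Complex.re h)
  have hre : 0 < (z * ξ).re := by
    rw [Complex.re_mul_ofReal]
    positivity
  have hfactor (y : ℝ) : ((y ^ α : ℝ) : ℂ) *
      ((ξ : ℂ) ^ n * Complex.exp (-((1 + z * y) * ξ))) = (ξ : ℂ) ^ n * Complex.exp (-ξ) *
        (((y ^ α : ℝ) : ℂ) * Complex.exp (-(z * ξ * y))) := by
    rw [show -((1 + z * y) * ξ) = -(ξ : ℂ) + -(z * ξ * y) by ring, Complex.exp_add]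
    ring
  have hpow : ((ξ ^ ((n : ℝ) - α - 1) : ℝ) : ℂ) =
      (ξ : ℂ) ^ n * ((ξ⁻¹ : ℝ) : ℂ) ^ ((α + 1 : ℝ) : ℂ) := by
    rw [← Complex.ofReal_cpow (by positivity), Real.inv_rpow hξ.le, sub_sub, Real.rpow_sub hξ,
      Real.rpow_natCast]
    push_cast
    rw [div_eq_mul_inv]
  simp_rw [hfactor]
  rw [integral_const_mul, integral_rpow_mul_cexp_neg_mul hα hre,
    show 1 / (z * ξ) = ((ξ⁻¹ : ℝ) : ℂ) * (1 / z) by push_cast; field_simp,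
    ofReal_mul_cpow (inv_pos.2 hξ) (one_div_ne_zero hz0), Complex.ofReal_mul, hpow]
  push_cast
  rw [one_mul]
  ring

theorem integral_rpow_mul_inv_one_add_mul_pow {α : ℝ} {n : ℕ} (hα : -1 < α) (hn : α < n) {z : ℂ}
    (hz : 0 < z.re) :
    ∫ y : ℝ in Set.Ioi 0, ((y ^ α : ℝ) : ℂ) * ((1 + z * y) ^ (n + 1))⁻¹ =
      ((Real.Gamma (α + 1) * Real.Gamma (n - α) / n ! : ℝ) : ℂ) * (1 / z) ^ (α + 1 : ℂ) := by
  have hy {y : ℝ} (hy : 0 < y) : ((y ^ α : ℝ) : ℂ) * ((1 + z * y) ^ (n + 1))⁻¹ =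
      (n ! : ℂ)⁻¹ * ∫ ξ : ℝ in Set.Ioi 0, ((y ^ α : ℝ) : ℂ) *
        ((ξ : ℂ) ^ n * Complex.exp (-((1 + z * y) * ξ))) := by
    have hre : 0 < (1 + z * y).re := by
      rw [Complex.add_re, Complex.one_re, Complex.re_mul_ofReal]
      positivity
    rw [integral_const_mul, integral_pow_mul_exp_neg_mul n hre, mul_left_comm,
      inv_mul_cancel_left₀ (by exact_mod_cast n.factorial_ne_zero)]
  rw [setIntegral_congr_fun measurableSet_Ioi fun y => hy, integral_const_mul,
    integral_integral_swap (integrable_rpow_mul_pow_mul_cexp hα hn hz),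
    setIntegral_congr_fun measurableSet_Ioi fun ξ => integral_rpow_mul_pow_mul_cexp n hα hz,
    integral_const_mul, integral_complex_ofReal,
    Real.integral_rpow_mul_exp_neg_mul_Ioi (by linarith) one_pos,
    one_div_one, Real.one_rpow, one_mul]
  push_cast
  ring

/-- The kernel `(1 + iy) ^ (-n - 1)`, a multiple of the Fourier transform of `ξ ^ n e ^ (-ξ)` on
the half line. -/
def kernel (n : ℕ) (y : ℝ) : ℂ := ((1 + Complex.I * y) ^ (n + 1))⁻¹

theorem kernel_neg (n : ℕ) (y : ℝ) : kernel n (-y) = (starRingEnd ℂ) (kernel n y) := by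
  simp [kernel]

theorem continuous_kernel (n : ℕ) : Continuous (kernel n) := by
  refine Continuous.inv₀ (by fun_prop) fun y => pow_ne_zero _ fun h => ?_
  simpa using congrArg Complex.re h

theorem norm_kernel (n : ℕ) (y : ℝ) : ‖kernel n y‖ = (1 + y ^ 2) ^ (-((n : ℝ) + 1) / 2) := by
  have hnorm : ‖1 + Complex.I * y‖ = (1 + y ^ 2) ^ (1 / 2 : ℝ) := by
    rw [← Real.sqrt_eq_rpow, mul_comm, ← Complex.ofReal_one, Complex.norm_add_mul_I, one_pow]
  rw [kernel, norm_inv, norm_pow, hnorm, ← Real.rpow_natCast, ← Real.rpow_mul (by positivity),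
    ← Real.rpow_neg (by positivity)]
  push_cast
  ring_nf

theorem integrable_abs_rpow_mul_kernel {α : ℝ} {n : ℕ} (hα : 0 ≤ α) (hn : α < n) :
    Integrable fun y : ℝ => ((|y| ^ α : ℝ) : ℂ) * kernel n y := by
  have hbracket : Integrable fun y : ℝ => (1 + ‖y‖ ^ 2) ^ (-((n : ℝ) + 1 - α) / 2) :=
    integrable_rpow_neg_one_add_norm_sq (by simp; linarith)
  refine hbracket.mono' ((Complex.continuous_ofReal.comp (continuous_abs.rpow_const fun _ =>
    .inr hα)).mul (continuous_kernel n)).aestronglyMeasurable (.of_forall fun y => ?_)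
  have hpos : 0 < 1 + y ^ 2 := by positivity
  rw [norm_mul, norm_kernel, Complex.norm_real, Real.norm_of_nonneg (by positivity),
    Real.norm_eq_abs, sq_abs]
  calc |y| ^ α * (1 + y ^ 2) ^ (-((n : ℝ) + 1) / 2)
      = (y ^ 2) ^ (α / 2) * (1 + y ^ 2) ^ (-((n : ℝ) + 1) / 2) := by
        rw [← sq_abs, ← Real.rpow_natCast, ← Real.rpow_mul (abs_nonneg y)]
        congr 2
        push_cast
        ring
    _ ≤ (1 + y ^ 2) ^ (α / 2) * (1 + y ^ 2) ^ (-((n : ℝ) + 1) / 2) := by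
        gcongr
        exact le_add_of_nonneg_left zero_le_one
    _ = (1 + y ^ 2) ^ (-((n : ℝ) + 1 - α) / 2) := by
        rw [← Real.rpow_add hpos]
        ring_nf

theorem integral_rpow_mul_kernel {α : ℝ} {n : ℕ} (hα : 0 ≤ α) (hn : α < n) :
    ∫ y : ℝ in Set.Ioi 0, ((y ^ α : ℝ) : ℂ) * kernel n y =
      ((Real.Gamma (α + 1) * Real.Gamma (n - α) / n ! : ℝ) : ℂ) *
        (1 / Complex.I) ^ (α + 1 : ℂ) := by
  have hδ : ∀ᶠ δ : ℝ in 𝓝[>] 0, 0 < δ := self_mem_nhdsWithin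
  have hpos : ∀ᵐ y : ℝ ∂volume.restrict (Set.Ioi 0), 0 < y := ae_restrict_mem measurableSet_Ioi
  have hcont {f : ℝ → ℂ} (hf : ContinuousAt f 0) : Tendsto f (𝓝[>] 0) (𝓝 (f 0)) :=
    hf.tendsto.mono_left nhdsWithin_le_nhds
  have hne {δ y : ℝ} (hy : 0 < y) : 1 + ((δ : ℂ) + Complex.I) * y ≠ 0 := by
    intro h
    simpa [hy.ne'] using congrArg Complex.im h
  have hlim : Tendsto (fun δ : ℝ => ∫ y : ℝ in Set.Ioi 0, ((y ^ α : ℝ) : ℂ) *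
      ((1 + ((δ : ℂ) + Complex.I) * y) ^ (n + 1))⁻¹) (𝓝[>] 0)
      (𝓝 (∫ y : ℝ in Set.Ioi 0, ((y ^ α : ℝ) : ℂ) * kernel n y)) := by
    refine tendsto_integral_filter_of_dominated_convergence _ (.of_forall fun δ =>
      Measurable.aestronglyMeasurable (by fun_prop)) ?_
      (integrable_abs_rpow_mul_kernel hα hn).norm.integrableOn ?_
    · filter_upwards [hδ] with δ hδ
      filter_upwards [hpos] with y hy
      rw [norm_mul, norm_mul, abs_of_pos hy, kernel, norm_inv, norm_inv, norm_pow, norm_pow]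
      have hpos : 0 < ‖1 + Complex.I * (y : ℂ)‖ := by
        simpa using hne (δ := 0) hy
      gcongr
      rw [Complex.norm_def, Complex.norm_def]
      gcongr
      simp [Complex.normSq_apply]
      nlinarith [mul_pos hδ hy]
    · filter_upwards [hpos] with y hy
      have hcont := hcont (f := fun δ : ℝ => ((y ^ α : ℝ) : ℂ) *
        ((1 + ((δ : ℂ) + Complex.I) * y) ^ (n + 1))⁻¹) <|
          continuousAt_const.mul (ContinuousAt.inv₀ (by fun_prop) (pow_ne_zero _ (hne hy)))
      simpa [kernel] using hcont
  have hpow : ContinuousAt (fun δ : ℝ => (1 / ((δ : ℂ) + Complex.I)) ^ (α + 1 : ℂ)) 0 := by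
    refine ContinuousAt.comp (g := fun w : ℂ => w ^ (α + 1 : ℂ)) (continuousAt_cpow_const ?_)
      (continuousAt_const.div (by fun_prop) (by simp))
    simp [Complex.mem_slitPlane_iff]
  have hlim' := (hcont hpow).const_mul
    ((Real.Gamma (α + 1) * Real.Gamma (n - α) / n ! : ℝ) : ℂ)
  rw [Complex.ofReal_zero, zero_add] at hlim'
  refine tendsto_nhds_unique hlim (hlim'.congr' ?_)
  filter_upwards [hδ] with δ hδ
  exact (integral_rpow_mul_inv_one_add_mul_pow (z := δ + Complex.I) (by linarith) hn
    (by simpa using hδ)).symm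

theorem re_one_div_I_cpow (α : ℝ) :
    ((1 / Complex.I) ^ (α + 1 : ℂ)).re = Real.cos ((α + 1) * (Real.pi / 2)) := by
  rw [one_div, Complex.inv_I, Complex.cpow_def_of_ne_zero (neg_ne_zero.2 Complex.I_ne_zero),
    Complex.log_neg_I,
    show -(Real.pi / 2 : ℂ) * Complex.I * (α + 1) =
      ((-((α + 1) * (Real.pi / 2)) : ℝ) : ℂ) * Complex.I by push_cast; ring,
    Complex.exp_ofReal_mul_I_re, Real.cos_neg]

theorem cos_add_one_mul_pi_div_two_ne_zero {α : ℝ} (hα : 0 ≤ α) (hα2 : ∀ k : ℕ, α ≠ 2 * k) :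
    Real.cos ((α + 1) * (Real.pi / 2)) ≠ 0 := by
  rw [Ne, Real.cos_eq_zero_iff]
  rintro ⟨k, hk⟩
  have hαk : α = 2 * k := by
    have := mul_right_cancel₀ Real.pi_pos.ne'
      (show (α + 1) * Real.pi = (2 * k + 1) * Real.pi by linarith)
    linarith
  have hk0 : 0 ≤ k := by
    have : (0 : ℝ) ≤ k := by linarith
    exact_mod_cast this
  lift k to ℕ using hk0
  exact hα2 k (by exact_mod_cast hαk)

theorem integral_abs_rpow_mul_kernel {α : ℝ} {n : ℕ} (hα : 0 ≤ α) (hn : α < n) :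
    ∫ y : ℝ, ((|y| ^ α : ℝ) : ℂ) * kernel n y =
      ((2 * (Real.Gamma (α + 1) * Real.Gamma (n - α) / n ! *
        Real.cos ((α + 1) * (Real.pi / 2))) : ℝ) : ℂ) := by
  have hint := integrable_abs_rpow_mul_kernel hα hn
  have hIoi : ∫ y : ℝ in Set.Ioi 0, ((|y| ^ α : ℝ) : ℂ) * kernel n y =
      ∫ y : ℝ in Set.Ioi 0, ((y ^ α : ℝ) : ℂ) * kernel n y :=
    setIntegral_congr_fun measurableSet_Ioi fun y hy => by
      simp only [abs_of_pos (Set.mem_Ioi.1 hy)]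
  have hIic : ∫ y : ℝ in Set.Iic 0, ((|y| ^ α : ℝ) : ℂ) * kernel n y =
      (starRingEnd ℂ) (∫ y : ℝ in Set.Ioi 0, ((|y| ^ α : ℝ) : ℂ) * kernel n y) := by
    rw [← integral_conj, ← neg_zero, ← integral_comp_neg_Ioi, neg_zero]
    simp only [abs_neg, kernel_neg, map_mul, Complex.conj_ofReal]
  rw [← intervalIntegral.integral_Iic_add_Ioi hint.integrableOn hint.integrableOn, hIic, add_comm,
    Complex.add_conj, hIoi, integral_rpow_mul_kernel hα hn, Complex.re_ofReal_mul,
    re_one_div_I_cpow]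

theorem integral_abs_rpow_mul_kernel_ne_zero {α : ℝ} {n : ℕ} (hα : 0 ≤ α)
    (hα2 : ∀ k : ℕ, α ≠ 2 * k) (hn : α < n) : ∫ y : ℝ, ((|y| ^ α : ℝ) : ℂ) * kernel n y ≠ 0 := by
  have hΓ : 0 < Real.Gamma (α + 1) := Real.Gamma_pos_of_pos (by linarith)
  have hΓn : 0 < Real.Gamma (n - α) := Real.Gamma_pos_of_pos (by linarith)
  have hcos := cos_add_one_mul_pi_div_two_ne_zero hα hα2
  rw [integral_abs_rpow_mul_kernel hα hn]
  refine Complex.ofReal_ne_zero.2 (mul_ne_zero two_ne_zero (mul_ne_zero ?_ hcos))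
  exact div_ne_zero (mul_ne_zero hΓ.ne' hΓn.ne') (by positivity)

/-! ### Singularities of the power chirp at `x = 0` -/

theorem factorial_mul_integral_mul_inv_add_mul_pow {f : ℝ → ℂ} (hf : Integrable f) (n : ℕ) (a : ℝ)
    {ε : ℝ} (hε : 0 < ε) :
    n ! * ∫ y : ℝ, f y * ((ε + Complex.I * (a * y : ℝ)) ^ (n + 1))⁻¹ =
      ∫ ξ : ℝ in Set.Ioi 0, ((ξ ^ n * Real.exp (-(ε * ξ)) : ℝ) : ℂ) * angularFourier f (ξ * a) := by
  have hre (y : ℝ) : 0 < ((ε : ℂ) + Complex.I * (a * y : ℝ)).re := by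
    simpa using hε
  have hfactor (y ξ : ℝ) : f y * ((ξ : ℂ) ^ n *
      Complex.exp (-((ε + Complex.I * (a * y : ℝ)) * ξ))) =
        Complex.exp (Complex.I * (-(ξ * a * y) : ℝ)) *
          (f y * ((ξ ^ n * Real.exp (-(ε * ξ)) : ℝ) : ℂ)) := by
    rw [show -(((ε : ℂ) + Complex.I * (a * y : ℝ)) * ξ) =
      ((-(ε * ξ) : ℝ) : ℂ) + Complex.I * (-(ξ * a * y) : ℝ) by push_cast; ring, Complex.exp_add]
    push_cast
    ring
  have hpow : IntegrableOn (fun ξ : ℝ => ((ξ ^ n * Real.exp (-(ε * ξ)) : ℝ) : ℂ)) (Set.Ioi 0) := by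
    have hreal := integrableOn_rpow_mul_exp_neg_mul
      (neg_one_lt_zero.trans_le (n.cast_nonneg (α := ℝ))) hε
    simp only [Real.rpow_natCast] at hreal
    exact hreal.ofReal
  have hint : Integrable (fun p : ℝ × ℝ => Complex.exp (Complex.I * (-(p.2 * a * p.1) : ℝ)) *
      (f p.1 * ((p.2 ^ n * Real.exp (-(ε * p.2)) : ℝ) : ℂ)))
      (volume.prod (volume.restrict (Set.Ioi 0))) :=
    (hf.mul_prod hpow).bdd_mul (c := 1) (Continuous.aestronglyMeasurable (by fun_prop))
      (.of_forall fun p => (Complex.norm_exp_I_mul_ofReal _).le)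
  calc n ! * ∫ y : ℝ, f y * ((ε + Complex.I * (a * y : ℝ)) ^ (n + 1))⁻¹
      = ∫ y : ℝ, ∫ ξ : ℝ in Set.Ioi 0, Complex.exp (Complex.I * (-(ξ * a * y) : ℝ)) *
          (f y * ((ξ ^ n * Real.exp (-(ε * ξ)) : ℝ) : ℂ)) := by
        rw [← integral_const_mul]
        refine integral_congr_ae (.of_forall fun y => ?_)
        simp only [← hfactor, integral_const_mul, integral_pow_mul_exp_neg_mul n (hre y)]
        ring
    _ = ∫ ξ : ℝ in Set.Ioi 0, ∫ y : ℝ, Complex.exp (Complex.I * (-(ξ * a * y) : ℝ)) *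
          (f y * ((ξ ^ n * Real.exp (-(ε * ξ)) : ℝ) : ℂ)) := integral_integral_swap hint
    _ = _ := by
        refine integral_congr_ae (.of_forall fun ξ => ?_)
        simp only [angularFourier, ← integral_const_mul]
        refine integral_congr_ae (.of_forall fun y => ?_)
        simp only [Complex.ofReal_neg, mul_neg]
        ring

theorem norm_integral_dilate_mul_kernel_le {f : ℝ → ℂ} (hf : Integrable f) {n : ℕ} {a : ℝ}
    (hdecay : IntegrableOn (fun ξ : ℝ => (ξ : ℂ) ^ n * angularFourier f (ξ * a)) (Set.Ioi 0))
    {ε : ℝ} (hε : 0 < ε) :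
    ‖∫ y : ℝ, f (ε * y) * kernel n (a * y)‖ ≤
      (∫ ξ : ℝ in Set.Ioi 0, ‖(ξ : ℂ) ^ n * angularFourier f (ξ * a)‖) * ε ^ n := by
  have hε' : (ε : ℂ) ≠ 0 := by exact_mod_cast hε.ne'
  have hkernel (y : ℝ) : f (ε * y) * kernel n (a * y) =
      (ε : ℂ) ^ (n + 1) * (f (ε * y) * ((ε + Complex.I * (a * (ε * y) : ℝ)) ^ (n + 1))⁻¹) := by
    rw [kernel, show (ε : ℂ) + Complex.I * (a * (ε * y) : ℝ) =
      ε * (1 + Complex.I * (a * y : ℝ)) by push_cast; ring, mul_pow, mul_inv, mul_left_comm,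
      mul_inv_cancel_left₀ (pow_ne_zero _ hε')]
  have hscale : ∫ y : ℝ, f (ε * y) * kernel n (a * y) = (ε : ℂ) ^ n *
      ∫ y : ℝ, f y * ((ε + Complex.I * (a * y : ℝ)) ^ (n + 1))⁻¹ := by
    simp_rw [hkernel]
    rw [integral_const_mul, Measure.integral_comp_mul_left
      (fun y => f y * ((ε + Complex.I * (a * y : ℝ)) ^ (n + 1))⁻¹), abs_of_pos (inv_pos.2 hε),
      Complex.real_smul, Complex.ofReal_inv, pow_succ]
    field_simp
  have hpair : ‖∫ y : ℝ, f y * ((ε + Complex.I * (a * y : ℝ)) ^ (n + 1))⁻¹‖ ≤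
      ∫ ξ : ℝ in Set.Ioi 0, ‖(ξ : ℂ) ^ n * angularFourier f (ξ * a)‖ := by
    have hfact : (1 : ℝ) ≤ n ! := by exact_mod_cast n.factorial_pos
    refine (le_mul_of_one_le_left (norm_nonneg _) hfact).trans ?_
    rw [← RCLike.norm_natCast (K := ℂ), ← norm_mul,
      factorial_mul_integral_mul_inv_add_mul_pow hf n a hε]
    refine norm_integral_le_of_norm_le hdecay.norm
      ((ae_restrict_mem measurableSet_Ioi).mono fun ξ hξ => ?_)
    have hξ : 0 < ξ := hξ
    rw [Complex.ofReal_mul, Complex.ofReal_pow, mul_right_comm, norm_mul _ (_ : ℂ),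
      Complex.norm_real, Real.norm_of_nonneg (Real.exp_nonneg _)]
    exact mul_le_of_le_one_right (norm_nonneg _) (Real.exp_le_one_iff.2 (by nlinarith))
  rw [hscale, norm_mul, norm_pow, Complex.norm_real, Real.norm_of_nonneg hε.le, mul_comm]
  gcongr

theorem abs_rpow_mul_kernel_mul (α : ℝ) (n : ℕ) {a : ℝ} (ha : a ≠ 0) (y : ℝ) :
    ((|y| ^ α : ℝ) : ℂ) * kernel n (a * y) =
      ((|a| ^ α : ℝ) : ℂ)⁻¹ * (((|a * y| ^ α : ℝ) : ℂ) * kernel n (a * y)) := by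
  have ha' : ((|a| ^ α : ℝ) : ℂ) ≠ 0 := by
    exact_mod_cast (Real.rpow_pos_of_pos (abs_pos.2 ha) α).ne'
  rw [abs_mul, Real.mul_rpow (abs_nonneg a) (abs_nonneg y), Complex.ofReal_mul, mul_assoc,
    inv_mul_cancel_left₀ ha']

theorem integrable_abs_rpow_mul_kernel_mul {α : ℝ} {n : ℕ} (hα : 0 ≤ α) (hn : α < n) {a : ℝ}
    (ha : a ≠ 0) : Integrable fun y : ℝ => ((|y| ^ α : ℝ) : ℂ) * kernel n (a * y) := by
  simp_rw [abs_rpow_mul_kernel_mul α n ha]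
  exact ((integrable_abs_rpow_mul_kernel hα hn).comp_mul_left' ha).const_mul _

theorem integral_abs_rpow_mul_kernel_mul_ne_zero {α : ℝ} {n : ℕ} (hα : 0 ≤ α)
    (hα2 : ∀ k : ℕ, α ≠ 2 * k) (hn : α < n) {a : ℝ} (ha : a ≠ 0) :
    ∫ y : ℝ, ((|y| ^ α : ℝ) : ℂ) * kernel n (a * y) ≠ 0 := by
  simp_rw [abs_rpow_mul_kernel_mul α n ha]
  rw [integral_const_mul,
    Measure.integral_comp_mul_left (fun y => ((|y| ^ α : ℝ) : ℂ) * kernel n y)]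
  refine mul_ne_zero (inv_ne_zero (Complex.ofReal_ne_zero.2
    (Real.rpow_pos_of_pos (abs_pos.2 ha) α).ne')) (smul_ne_zero (abs_ne_zero.2 (inv_ne_zero ha))
      (integral_abs_rpow_mul_kernel_ne_zero hα hα2 hn))

theorem tendsto_integral_dilate_mul_kernel {α : ℝ} {n : ℕ} (hα : 0 ≤ α) (hn : α < n) {a : ℝ}
    (ha : a ≠ 0) {f : ℝ → ℂ} (hf : Continuous f) {D : ℝ} (hD : ∀ y, ‖f y‖ ≤ D * |y| ^ α) {b : ℂ}
    (hb : Tendsto (fun y => f y / (|y| ^ α : ℝ)) (𝓝[≠] 0) (𝓝 b)) :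
    Tendsto (fun ε : ℝ => ((ε ^ α : ℝ) : ℂ)⁻¹ * ∫ y : ℝ, f (ε * y) * kernel n (a * y)) (𝓝[>] 0)
      (𝓝 (b * ∫ y : ℝ, ((|y| ^ α : ℝ) : ℂ) * kernel n (a * y))) := by
  have hker := continuous_kernel n
  simp_rw [← integral_const_mul]
  refine tendsto_integral_filter_of_dominated_convergence _ (.of_forall fun ε =>
    Continuous.aestronglyMeasurable (by fun_prop)) ?_
    ((integrable_abs_rpow_mul_kernel_mul hα hn ha).norm.const_mul D) ?_
  · filter_upwards [self_mem_nhdsWithin] with ε hε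
    have hε : 0 < ε := hε
    refine .of_forall fun y => ?_
    have hpow : 0 < ε ^ α := Real.rpow_pos_of_pos hε α
    rw [norm_mul, norm_mul, norm_mul, norm_inv, Complex.norm_real, Complex.norm_real,
      Real.norm_of_nonneg hpow.le, Real.norm_of_nonneg (by positivity), inv_mul_le_iff₀ hpow]
    calc ‖f (ε * y)‖ * ‖kernel n (a * y)‖
        ≤ D * |ε * y| ^ α * ‖kernel n (a * y)‖ := by gcongr; exact hD _
      _ = ε ^ α * (D * (|y| ^ α * ‖kernel n (a * y)‖)) := by
        rw [abs_mul, abs_of_pos hε, Real.mul_rpow hε.le (abs_nonneg y)]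
        ring
  · filter_upwards [compl_mem_ae_iff.2 (measure_singleton (0 : ℝ))] with y hy
    have hy : y ≠ 0 := hy
    have hscale : Tendsto (fun ε : ℝ => ε * y) (𝓝[>] 0) (𝓝[≠] 0) :=
      tendsto_nhdsWithin_of_tendsto_nhds_of_eventually_within _
        ((Continuous.tendsto' (by fun_prop) 0 0 (zero_mul y)).mono_left nhdsWithin_le_nhds)
        (eventually_mem_nhdsWithin.mono fun ε hε => mul_ne_zero (ne_of_gt hε) hy)
    have hlim := (hb.comp hscale).mul_const (((|y| ^ α : ℝ) : ℂ) * kernel n (a * y))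
    refine hlim.congr' (eventually_mem_nhdsWithin.mono fun ε hε => ?_)
    have hε : 0 < ε := hε
    have hy' : ((|y| ^ α : ℝ) : ℂ) ≠ 0 := by
      exact_mod_cast (Real.rpow_pos_of_pos (abs_pos.2 hy) α).ne'
    simp only [Function.comp_apply, abs_mul, abs_of_pos hε, Real.mul_rpow hε.le (abs_nonneg y),
      Complex.ofReal_mul]
    field_simp

theorem eq_zero_of_tendsto_div_abs_rpow {α : ℝ} (hα : 0 ≤ α) (hα2 : ∀ k : ℕ, α ≠ 2 * k) {a : ℝ}
    (ha : a ≠ 0) {f : ℝ → ℂ} (hf : Continuous f) (hfi : Integrable f)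
    (hdecay : ∀ n : ℕ,
      IntegrableOn (fun ξ : ℝ => (ξ : ℂ) ^ n * angularFourier f (ξ * a)) (Set.Ioi 0))
    {D : ℝ} (hD : ∀ y, ‖f y‖ ≤ D * |y| ^ α) {b : ℂ}
    (hb : Tendsto (fun y => f y / (|y| ^ α : ℝ)) (𝓝[≠] 0) (𝓝 b)) : b = 0 := by
  obtain ⟨n, hn⟩ := exists_nat_gt α
  have hlim := tendsto_integral_dilate_mul_kernel hα hn ha hf hD hb
  have hzero : Tendsto (fun ε : ℝ => ((ε ^ α : ℝ) : ℂ)⁻¹ *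
      ∫ y : ℝ, f (ε * y) * kernel n (a * y)) (𝓝[>] 0) (𝓝 0) := by
    set B := ∫ ξ : ℝ in Set.Ioi 0, ‖(ξ : ℂ) ^ n * angularFourier f (ξ * a)‖
    have hrpow : Tendsto (fun ε : ℝ => B * ε ^ (n - α)) (𝓝[>] 0) (𝓝 0) := by
      have hcont : ContinuousAt (fun ε : ℝ => B * ε ^ (n - α)) 0 :=
        continuousAt_const.mul (Real.continuousAt_rpow_const _ _ (.inr (sub_nonneg.2 hn.le)))
      simpa [Real.zero_rpow (sub_pos.2 hn).ne'] using hcont.tendsto.mono_left nhdsWithin_le_nhds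
    refine squeeze_zero_norm' (eventually_mem_nhdsWithin.mono fun ε hε => ?_) hrpow
    have hε : 0 < ε := hε
    rw [norm_mul, norm_inv, Complex.norm_real, Real.norm_of_nonneg (by positivity),
      Real.rpow_sub hε, Real.rpow_natCast, inv_mul_le_iff₀ (by positivity)]
    refine (norm_integral_dilate_mul_kernel_le hfi (hdecay n) hε).trans_eq ?_
    rw [mul_left_comm, mul_div_cancel₀ _ (Real.rpow_pos_of_pos hε α).ne']
  exact (mul_eq_zero.1 (tendsto_nhds_unique hlim hzero)).resolve_right
    (integral_abs_rpow_mul_kernel_mul_ne_zero hα hα2 hn ha)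

theorem isBigO_angularFourier_of_decaysNear {t s : ℝ} {ht : 0 < t} {hs : 0 < s} {ψ : Space t s}
    {θ : ℝ → ℝ} {hθ : Continuous θ} {ξ₀ : ℝ}
    (h : DecaysNear ht hs ψ (ofFunction t s (oscillation θ hθ)) (0, ξ₀)) (x : ℝ) :
    (fun k : ℝ => angularFourier (windowedOscillation θ ψ x) (k * ξ₀)) =O[atTop]
      fun k => Real.exp (-(1 * k ^ s⁻¹)) := by
  obtain ⟨U, hU, -, hmem, hdecay⟩ := h
  obtain ⟨C, hC⟩ := hdecay 1 one_pos
  have hlim : Tendsto (fun k : ℝ => (x * k ^ (-(s⁻¹ * t)), ξ₀)) atTop (𝓝 (0, ξ₀)) := by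
    have hx := (tendsto_rpow_neg_atTop (show 0 < s⁻¹ * t by positivity)).const_mul x
    rw [mul_zero] at hx
    exact hx.prodMk_nhds tendsto_const_nhds
  refine Asymptotics.IsBigO.of_bound (stftConst⁻¹ * C) ?_
  filter_upwards [hlim.eventually (hU.mem_nhds hmem), eventually_gt_atTop 0] with k hkU hk
  have hxk : (k ^ s⁻¹) ^ t * (x * k ^ (-(s⁻¹ * t))) = x := by
    rw [← Real.rpow_mul hk.le, mul_left_comm, ← Real.rpow_add hk, add_neg_cancel, Real.rpow_zero,
      mul_one]
  have hξk : (k ^ s⁻¹) ^ s * ξ₀ = k * ξ₀ := by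
    rw [Real.rpow_inv_rpow hk.le hs.ne']
  have hbound := hC (k ^ s⁻¹) (by positivity) _ hkU
  rw [hxk, hξk, norm_stft_oscillation ht hs ψ hθ, ← le_div_iff₀' (Real.exp_pos _), div_eq_mul_inv,
    ← Real.exp_neg, ← le_div_iff₀' stftConst_pos] at hbound
  rw [Real.norm_of_nonneg (Real.exp_nonneg _)]
  exact hbound.trans_eq (by ring)

theorem integrableOn_pow_mul_angularFourier {f : ℝ → ℂ} (hf : Integrable f) {a p : ℝ} (hp : 0 < p)
    (hdecay : (fun k : ℝ => angularFourier f (k * a)) =O[atTop]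
      fun k => Real.exp (-(1 * k ^ p))) (n : ℕ) :
    IntegrableOn (fun ξ : ℝ => (ξ : ℂ) ^ n * angularFourier f (ξ * a)) (Set.Ioi 0) := by
  have hcont : Continuous fun ξ : ℝ => (ξ : ℂ) ^ n * angularFourier f (ξ * a) := by
    have := continuous_angularFourier hf
    fun_prop
  have hexp : IntegrableOn (fun ξ : ℝ => ξ ^ n * Real.exp (-(1 * ξ ^ p))) (Set.Ioi 0) := by
    have hreal := integrableOn_rpow_mul_exp_neg_mul_rpow (p := p)
      (neg_one_lt_zero.trans_le (n.cast_nonneg (α := ℝ))) hp one_pos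
    simpa only [Real.rpow_natCast, neg_mul] using hreal
  have hO : (fun ξ : ℝ => (ξ : ℂ) ^ n * angularFourier f (ξ * a)) =O[atTop]
      fun ξ => ξ ^ n * Real.exp (-(1 * ξ ^ p)) :=
    (Asymptotics.isBigO_of_le _ fun ξ => by simp).mul hdecay
  exact (hcont.locallyIntegrable.locallyIntegrableOn _ |>.integrableOn_of_isBigO_atTop hO
    ⟨Set.Ioi 0, Ioi_mem_atTop 0, hexp⟩).mono_set Set.Ioi_subset_Ici_self

theorem angularFourier_sub {f g : ℝ → ℂ} (hf : Integrable f) (hg : Integrable g) (ξ : ℝ) :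
    angularFourier (f - g) ξ = angularFourier f ξ - angularFourier g ξ := by
  have hint {f : ℝ → ℂ} (hf : Integrable f) :
      Integrable fun y : ℝ => Complex.exp (-(Complex.I * (ξ * y : ℝ))) * f y := by
    refine hf.bdd_mul (c := 1) (Continuous.aestronglyMeasurable (by fun_prop))
      (.of_forall fun y => ?_)
    rw [← mul_neg, ← Complex.ofReal_neg, Complex.norm_exp_I_mul_ofReal]
  simp only [angularFourier, ← integral_sub (hint hf) (hint hg), Pi.sub_apply, mul_sub]

section Perturbation

variable {t s : ℝ} (c : ℝ) {α : ℝ} (ψ : Space t s) (x : ℝ)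

theorem windowedOscillation_sub (θ : ℝ → ℝ) (y : ℝ) :
    (windowedOscillation θ ψ x - windowedOscillation (fun _ => 0) ψ x) y =
      (Complex.exp (Complex.I * θ y) - 1) * (starRingEnd ℂ) ((ψ : ℝ → ℂ) (y - x)) := by
  simp [windowedOscillation, sub_mul]

theorem exists_norm_windowedOscillation_sub_le (ht : 0 < t) :
    ∃ D, ∀ y, ‖(windowedOscillation (fun y => c * |y| ^ α) ψ x -
      windowedOscillation (fun _ => 0) ψ x) y‖ ≤ D * |y| ^ α := by
  obtain ⟨C, hC, hψ⟩ := exists_norm_coe_le ht ψ one_pos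
  refine ⟨|c| * C, fun y => ?_⟩
  rw [windowedOscillation_sub, norm_mul, RCLike.norm_conj]
  calc ‖Complex.exp (Complex.I * (c * |y| ^ α : ℝ)) - 1‖ * ‖(ψ : ℝ → ℂ) (y - x)‖
      ≤ ‖c * |y| ^ α‖ * C := by
        gcongr
        · exact Real.norm_exp_I_mul_ofReal_sub_one_le
        · refine (hψ _).trans (mul_le_of_le_one_right hC (Real.exp_le_one_iff.2 ?_))
          exact neg_nonpos.2 (by positivity)
    _ = |c| * C * |y| ^ α := by
        rw [norm_mul, Real.norm_eq_abs, Real.norm_of_nonneg (by positivity)]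
        ring

theorem tendsto_windowedOscillation_sub_div (hα : 0 < α) :
    Tendsto (fun y => (windowedOscillation (fun y => c * |y| ^ α) ψ x -
        windowedOscillation (fun _ => 0) ψ x) y / (|y| ^ α : ℝ)) (𝓝[≠] 0)
      (𝓝 (Complex.I * c * (starRingEnd ℂ) ((ψ : ℝ → ℂ) (-x)))) := by
  have hexp :
      HasDerivAt (fun τ : ℝ => Complex.exp (Complex.I * (c * τ : ℝ))) (Complex.I * c) 0 := by
    have h := ((((hasDerivAt_id (0 : ℝ)).const_mul c).ofReal_comp).const_mul Complex.I).cexp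
    simpa using h
  have hpow : Tendsto (fun y : ℝ => |y| ^ α) (𝓝[≠] 0) (𝓝[≠] 0) := by
    refine tendsto_nhdsWithin_of_tendsto_nhds_of_eventually_within _
      (Tendsto.mono_left ?_ nhdsWithin_le_nhds)
      (eventually_mem_nhdsWithin.mono fun y hy => (Real.rpow_pos_of_pos (abs_pos.2 hy) α).ne')
    exact (continuous_abs.rpow_const fun _ => .inr hα.le).tendsto' 0 0 (by simp [hα.ne'])
  have hψ : Tendsto (fun y => (starRingEnd ℂ) ((ψ : ℝ → ℂ) (y - x))) (𝓝[≠] 0)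
      (𝓝 ((starRingEnd ℂ) ((ψ : ℝ → ℂ) (-x)))) :=
    (((contDiff_conj_coe ψ).continuous.comp (continuous_sub_right x)).tendsto' 0 _
      (by simp)).mono_left nhdsWithin_le_nhds
  refine ((hexp.tendsto_slope_zero.comp hpow).mul hψ).congr fun y => ?_
  rw [windowedOscillation_sub]
  simp [div_eq_inv_mul, mul_assoc]

end Perturbation

theorem not_decaysNear_powerChirp {c α t : ℝ} (hc : c ≠ 0) (hα : 1 < α)
    (hα2 : ∀ k : ℕ, α ≠ 2 * k) (ht : 0 < t) (hs : 1 ≤ t * (α - 1))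
    {ψ : Space t (t * (α - 1))} (hψ : ψ ≠ 0) {ξ₀ : ℝ} (hξ₀ : ξ₀ ≠ 0) :
    ¬ DecaysNear ht (zero_lt_one.trans_le hs) ψ
      (ofFunction t _ (powerChirp c α (zero_le_one.trans hα.le))) (0, ξ₀) := by
  intro hchirp
  have hα0 : 0 < α := zero_lt_one.trans hα
  have hfree : DecaysNear ht (zero_lt_one.trans_le hs) ψ
      (ofFunction t _ (oscillation (fun _ => 0) continuous_const)) (0, ξ₀) :=
    decaysNear_of_deriv_ne ht hs ψ continuous_const (by simp) analyticAt_const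
      (by simpa using hξ₀.symm) (by simp [hξ₀])
  have hvanish (x : ℝ) : (ψ : ℝ → ℂ) (-x) = 0 := by
    have hθ : Continuous fun y : ℝ => c * |y| ^ α :=
      continuous_const.mul (continuous_abs.rpow_const fun _ => .inr hα0.le)
    have hint := integrable_windowedOscillation hθ ψ x
    have hint₀ := integrable_windowedOscillation continuous_const (θ := fun _ => 0) ψ x
    have hO := (isBigO_angularFourier_of_decaysNear hchirp x).sub
      (isBigO_angularFourier_of_decaysNear hfree x)
    simp_rw [← angularFourier_sub hint hint₀] at hO
    obtain ⟨D, hD⟩ := exists_norm_windowedOscillation_sub_le c (α := α) ψ x ht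
    have hzero := eq_zero_of_tendsto_div_abs_rpow hα0.le hα2 hξ₀
      ((continuous_windowedOscillation hθ ψ x).sub
        (continuous_windowedOscillation continuous_const ψ x))
      (hint.sub hint₀)
      (integrableOn_pow_mul_angularFourier (hint.sub hint₀)
        (inv_pos.2 (zero_lt_one.trans_le hs)) hO) hD
      (tendsto_windowedOscillation_sub_div c ψ x hα0)
    simpa [hc] using hzero
  refine hψ (Subtype.ext (funext fun y => ?_))
  simpa using hvanish (-y)

theorem waveFrontSet_powerChirp_subset {c α t : ℝ} (hα : 1 < α) (ht : 0 < t)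
    (hs : 1 ≤ t * (α - 1)) (ψ : Space t (t * (α - 1))) :
    waveFrontSet ht (zero_lt_one.trans_le hs) ψ
        (ofFunction t _ (powerChirp c α (zero_le_one.trans hα.le))) ⊆
      {p | ∃ x : ℝ, x ≠ 0 ∧ p = (x, c * α * Real.sign x * |x| ^ (α - 1))} ∪
        {p | p.1 = 0 ∧ p.2 ≠ 0} := by
  rintro ⟨x, ξ⟩ hz
  obtain ⟨hz0, hz⟩ := mem_waveFrontSet_iff.1 hz
  rcases eq_or_ne x 0 with rfl | hx
  · exact .inr ⟨rfl, by simpa using hz0⟩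
  · refine .inl ⟨x, hx, ?_⟩
    by_contra hne
    exact hz (decaysNear_powerChirp hα ht hs ψ hx (by simpa [eq_comm] using hne))

theorem one_lt_index {β t : ℝ} (hβ : 1 < β) (ht : 1 / (β - 1) < t) : 1 < t * (β - 1) :=
  (div_lt_iff₀ (sub_pos.2 hβ)).1 ht

end GelfandShilov

end

theorem theorem4p2_general (c : ℝ) (hc : c ≠ 0) :
    (∀ m : ℕ, 2 ≤ m → ∀ (t : ℝ) (ht : 0 < t) (hs : 1 ≤ t * ((m : ℝ) - 1))
      (ψ : GelfandShilov.Space t (t * ((m : ℝ) - 1))), ψ ≠ 0 →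
      GelfandShilov.waveFrontSet ht (zero_lt_one.trans_le hs) ψ
          (GelfandShilov.ofFunction t (t * ((m : ℝ) - 1)) (GelfandShilov.monomialChirp c m)) =
        {p : ℝ × ℝ | ∃ x : ℝ, x ≠ 0 ∧ p = (x, c * m * x ^ (m - 1))}) ∧
    (∀ (α : ℝ) (hα : 1 < α), (∀ k : ℕ, α ≠ 2 * k) → ∀ (t : ℝ) (ht : 0 < t)
      (hs : 1 ≤ t * (α - 1)) (ψ : GelfandShilov.Space t (t * (α - 1))), ψ ≠ 0 →
      {p : ℝ × ℝ | p.1 = 0 ∧ p.2 ≠ 0} ⊆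
        GelfandShilov.waveFrontSet ht (zero_lt_one.trans_le hs) ψ
          (GelfandShilov.ofFunction t (t * (α - 1))
            (GelfandShilov.powerChirp c α (zero_le_one.trans hα.le))) ∧
      GelfandShilov.waveFrontSet ht (zero_lt_one.trans_le hs) ψ
          (GelfandShilov.ofFunction t (t * (α - 1))
            (GelfandShilov.powerChirp c α (zero_le_one.trans hα.le))) ⊆
        {p : ℝ × ℝ | ∃ x : ℝ, x ≠ 0 ∧ p = (x, c * α * Real.sign x * |x| ^ (α - 1))} ∪
          {p : ℝ × ℝ | p.1 = 0 ∧ p.2 ≠ 0}) := by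
  refine ⟨fun m hm t ht hs ψ => GelfandShilov.waveFrontSet_monomialChirp hm ht hs,
    fun α hα hα2 t ht hs ψ hψ => ⟨?_, GelfandShilov.waveFrontSet_powerChirp_subset hα ht hs ψ⟩⟩
  rintro ⟨x, ξ⟩ ⟨rfl, hξ⟩
  exact GelfandShilov.mem_waveFrontSet_iff.2 ⟨by simpa using hξ,
    GelfandShilov.not_decaysNear_powerChirp hc hα hα2 ht hs hψ hξ⟩

theorem theorem4p2 (c : ℝ) (hc : c ≠ 0) :
    (∀ (m : ℕ) (hm : 2 ≤ m) (t : ℝ) (ht : 1 / ((m : ℝ) - 1) < t)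
      (ψ : GelfandShilov.Space t (t * ((m : ℝ) - 1))), ψ ≠ 0 →
      GelfandShilov.waveFrontSet
          (GelfandShilov.index_pos (Nat.one_lt_cast.2 hm) ht)
          (GelfandShilov.index_mul_pos (Nat.one_lt_cast.2 hm) ht) ψ
          (GelfandShilov.ofFunction t (t * ((m : ℝ) - 1)) (GelfandShilov.monomialChirp c m)) =
        {p : ℝ × ℝ | ∃ x : ℝ, x ≠ 0 ∧ p = (x, c * m * x ^ (m - 1))}) ∧
    (∀ (α : ℝ) (hα : 1 < α), (∀ k : ℕ, α ≠ 2 * k) → ∀ (t : ℝ) (ht : 1 / (α - 1) < t)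
      (ψ : GelfandShilov.Space t (t * (α - 1))), ψ ≠ 0 →
      {p : ℝ × ℝ | p.1 = 0 ∧ p.2 ≠ 0} ⊆
        GelfandShilov.waveFrontSet
          (GelfandShilov.index_pos hα ht) (GelfandShilov.index_mul_pos hα ht) ψ
          (GelfandShilov.ofFunction t (t * (α - 1))
            (GelfandShilov.powerChirp c α (zero_le_one.trans hα.le))) ∧
      GelfandShilov.waveFrontSet
          (GelfandShilov.index_pos hα ht) (GelfandShilov.index_mul_pos hα ht) ψ
          (GelfandShilov.ofFunction t (t * (α - 1))
            (GelfandShilov.powerChirp c α (zero_le_one.trans hα.le))) ⊆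
        {p : ℝ × ℝ | ∃ x : ℝ, x ≠ 0 ∧ p = (x, c * α * Real.sign x * |x| ^ (α - 1))} ∪
          {p : ℝ × ℝ | p.1 = 0 ∧ p.2 ≠ 0}) := by
  obtain ⟨hmonomial, hpower⟩ := theorem4p2_general c hc
  exact ⟨fun m hm t ht => hmonomial m hm t _
      (GelfandShilov.one_lt_index (Nat.one_lt_cast.2 hm) ht).le,
    fun α hα hα2 t ht => hpower α hα hα2 t _ (GelfandShilov.one_lt_index hα ht).le⟩
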